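/- Let $M$ be a compact Hausdorff space with a finite Radon measure $\mu$, and let $\mathcal E$ be a Dirichlet form on $L^2(M,\mu)$: a nonnegative closed symmetric bilinear form on a dense subspace $\mathcal D(\mathcal E)\subset L^2(M,\mu)$ such that $|v|\in\mathcal D(\mathcal E)$ and $\mathcal E(|v|)\le\mathcal E(v)$ for $v\in\mathcal D(\mathcal E)$, and $\inf\{v,1\}\in\mathcal D(\mathcal E)$ and $\mathcal E(\inf\{v,1\})\le\mathcal E(v)$ for $0\le v\in\mathcal D(\mathcal E)$; here $\mathcal E(v)=\mathcal E(v,v)$. Assume that $\mathcal E$ is * regular: $\mathcal D(\mathcal E)\cap C^0(M)$ is dense in $C^0(M)$ for the uniform norm and in $\mathcal D(\mathcal E)$ for the norm $(\mathcal E(u)+\|u\|_{L^2}^2)^{1/2}$; * strongly local: $\mathcal E(u,v)=0$ whenever $u,v\in\mathcal D(\mathcal E)$ and $u$ is constant in a neighbourhood of $\operatorname{supp} v$. For $u\in\mathcal D(\mathcal E)\cap C^0(M)$ let $\gamma(u,u)$ be its energy measure, i.e. the Radon measure with $\mathcal E(\varphi u,u)-\tfrac12\mathcal E(\varphi,u^2)=\int_M\varphi\,d\gamma(u,u)$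 for all $\varphi\in\mathcal D(\mathcal E)\cap C^0(M)$, and let $$d(x,y)=\sup\{u(x)-u(y): u\in\mathcal D(\mathcal E)\cap C^0(M),\ d\gamma(u,u)\le d\mu\}\in[0,\infty]$$ be the intrinsic distance, where $d\gamma(u,u)\le d\mu$ means that $d\gamma(u,u)=f\,d\mu$ for some function $f\le1$. Assume that $d$ is compatible with the topology of $M$: for every $x$ the balls $B(x,r)=\{y: d(x,y)<r\}$, $r>0$, form a basis of neighbourhoods of $x$. Let $\nu>2$ and $q=\frac{2\nu}{\nu-2}$. For $U\subset M$ let $A_{\mathrm{opt}}(U)\in[0,\infty]$ be the infimum of all $A>0$ for which there is $B>0$ such that $$\|v\|_{L^q}^2\le A\,\mathcal E(v)+B\,\|v\|_{L^2}^2\qquad\text{for all } v\in\mathcal D(\mathcal E)\text{ with }\operatorname{supp}v\subset U$$ (with $\inf\emptyset=\infty$), let $A_{\mathrm{opt}}=A_{\mathrm{opt}}(M)$, and let $$S(U)=\inf\{\mathcal E(u): u\in\mathcal D(\mathcal E),\ \|u\|_{L^q}=1,\ \operatorname{supp}u\subset U\}\in[0,\infty].$$ Then, for every $x\in M$, the limits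 of $A_{\mathrm{opt}}(B(x,r))$ and of $S(B(x,r))$ as $r\searrow0$ exist in $[0,\infty]$, and $$A_{\mathrm{opt}}=\sup_{x\in M}\lim_{r\searrow0}A_{\mathrm{opt}}(B(x,r)).$$ Suppose moreover that $\mu(\{x\})=0$ for every $x\in M$. Put $S_\ell=\inf_{x\in M}\lim_{r\searrow0}S(B(x,r))$. If $A_{\mathrm{opt}}$ is finite, then $$A_{\mathrm{opt}}=\frac1{S_\ell}\qquad(\text{with } 1/\infty=0;\text{ in particular } S_\ell>0).$$ If $V$ is a real-valued $\mu$-integrable function such that $|V|$ is infinitesimally form bounded, i.e. for every $\varepsilon>0$ there is $c(\varepsilon)$ with $\int_M|V|v^2\,d\mu\le\varepsilon\,\mathcal E(v)+c(\varepsilon)\int_M v^2\,d\mu$ for all $v\in\mathcal D(\mathcal E)$, then, with $\mathcal E_V(u)=\mathcal E(u)+\int_M Vu^2\,d\mu$ and $$Y(U)=\inf\{\mathcal E_V(u): u\in\mathcal D(\mathcal E),\ \|u\|_{L^q}=1,\ \operatorname{supp}u\subset U\}\in[-\infty,\infty],$$ the limits of $Y(B(x,r))$ as $r\searrow0$ exist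 in $[-\infty,\infty]$ and $$S_\ell=Y_\ell:=\inf_{x\in M}\lim_{r\searrow0}Y(B(x,r)).$$ -/

import Mathlib

open MeasureTheory Filter Topology
open scoped ENNReal

noncomputable section

/-- A Dirichlet form on `L²(M, μ)`: a nonnegative closed symmetric bilinear form `ℰ` on a dense
subspace `𝒟(ℰ)` of `L²(M, μ)`, which is sub-Markovian in the sense of Beurling and Deny. -/
structure DirichletForm {M : Type*} [MeasurableSpace M] (μ : Measure M) [IsFiniteMeasure μ] where
  /-- the domain `𝒟(ℰ)` -/
  domain : Submodule ℝ (Lp ℝ 2 μ)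
  /-- the bilinear form `ℰ` on `𝒟(ℰ)` -/
  form : LinearMap.BilinForm ℝ domain
  dense_domain : Dense (domain : Set (Lp ℝ 2 μ))
  symm : ∀ u v : domain, form u v = form v u
  nonneg : ∀ u : domain, 0 ≤ form u u
  /-- `𝒟(ℰ)` is complete for the norm `(ℰ(u) + ‖u‖²)^(1/2)` -/
  closed : ∀ u : ℕ → domain,
    (∀ ε > 0, ∃ N, ∀ m ≥ N, ∀ n ≥ N,
      form (u m - u n) (u m - u n) + ‖((u m - u n : domain) : Lp ℝ 2 μ)‖ ^ 2 < ε) →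
    ∃ v : domain, Tendsto
      (fun n => form (u n - v) (u n - v) + ‖((u n - v : domain) : Lp ℝ 2 μ)‖ ^ 2) atTop (𝓝 0)
  /-- if `v ∈ 𝒟(ℰ)`, then `|v| ∈ 𝒟(ℰ)` and `ℰ(|v|) ≤ ℰ(v)` -/
  markov_abs : ∀ v : domain, ∃ h : |(v : Lp ℝ 2 μ)| ∈ domain,
    form ⟨|(v : Lp ℝ 2 μ)|, h⟩ ⟨|(v : Lp ℝ 2 μ)|, h⟩ ≤ form v v
  /-- if `0 ≤ v ∈ 𝒟(ℰ)`, then `inf{v, 1} ∈ 𝒟(ℰ)` and `ℰ(inf{v, 1}) ≤ ℰ(v)` -/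
  markov_inf : ∀ v : domain, 0 ≤ (v : Lp ℝ 2 μ) →
    ∃ h : (v : Lp ℝ 2 μ) ⊓ Lp.const 2 μ (1 : ℝ) ∈ domain,
      form ⟨(v : Lp ℝ 2 μ) ⊓ Lp.const 2 μ (1 : ℝ), h⟩
        ⟨(v : Lp ℝ 2 μ) ⊓ Lp.const 2 μ (1 : ℝ), h⟩ ≤ form v v

namespace DirichletForm

/-- The (closed) support of a class of functions modulo `μ`-null sets: the complement of the
set of points near which the function vanishes almost everywhere. -/
def essSupport {M : Type*} [TopologicalSpace M] [MeasurableSpace M] (μ : Measure M)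
    (f : M → ℝ) : Set M :=
  {x | ∀ O ∈ 𝓝 x, ¬ (∀ᵐ y ∂μ, y ∈ O → f y = 0)}

variable {M : Type*} [TopologicalSpace M] [CompactSpace M] [MeasurableSpace M] [BorelSpace M]
  {μ : Measure M} [IsFiniteMeasure μ]

/-- `𝒟(ℰ) ∩ C⁰(M)`: the continuous functions whose `L²` class lies in the domain. -/
def contDomain (E : DirichletForm μ) : Set C(M, ℝ) :=
  {f | ContinuousMap.toLp 2 μ ℝ f ∈ E.domain}

/-- Regularity: `𝒟(ℰ) ∩ C⁰(M)` is dense in `C⁰(M)` for the uniform norm and in `𝒟(ℰ)` for the norm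
`(ℰ(u) + ‖u‖²)^(1/2)`. -/
def IsRegular (E : DirichletForm μ) : Prop :=
  Dense E.contDomain ∧
  ∀ u : E.domain, ∀ ε > 0, ∃ v : E.domain,
    (∃ f ∈ E.contDomain, ContinuousMap.toLp 2 μ ℝ f = (v : Lp ℝ 2 μ)) ∧
    E.form (u - v) (u - v) + ‖((u - v : E.domain) : Lp ℝ 2 μ)‖ ^ 2 < ε

/-- Strong locality: `ℰ(u, v) = 0` whenever `u` is (almost everywhere) constant in a neighbourhood
of the support of `v`. -/
def IsStronglyLocal (E : DirichletForm μ) : Prop :=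
  ∀ u v : E.domain,
    (∃ O : Set M, IsOpen O ∧ essSupport μ (v : Lp ℝ 2 μ) ⊆ O ∧
      ∃ c : ℝ, ∀ᵐ y ∂μ, y ∈ O → (u : Lp ℝ 2 μ) y = c) →
    E.form u v = 0

/-- `γ` is the energy measure `γ(u, u)` of `u ∈ 𝒟(ℰ) ∩ C⁰(M)`: the Radon measure such that
`ℰ(φ u, u) - ½ ℰ(φ, u²) = ∫ φ dγ` for all `φ ∈ 𝒟(ℰ) ∩ C⁰(M)`. The products `φ u` and `u²` always lie
in `𝒟(ℰ)`, because the bounded functions of `𝒟(ℰ)` form an algebra; so the two memberships stated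
below are no restriction. -/
def IsEnergyMeasure (E : DirichletForm μ) (u : C(M, ℝ)) (γ : Measure M) : Prop :=
  IsFiniteMeasure γ ∧ γ.Regular ∧
  ∃ hu : ContinuousMap.toLp 2 μ ℝ u ∈ E.domain,
    ∀ φ : C(M, ℝ), ∀ hφ : ContinuousMap.toLp 2 μ ℝ φ ∈ E.domain,
      ∃ (hφu : ContinuousMap.toLp 2 μ ℝ (φ * u) ∈ E.domain)
        (huu : ContinuousMap.toLp 2 μ ℝ (u * u) ∈ E.domain),
        E.form ⟨_, hφu⟩ ⟨_, hu⟩ - 1 / 2 * E.form ⟨_, hφ⟩ ⟨_, huu⟩ = ∫ x, φ x ∂γ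

/-- `dγ(u, u) ≤ dμ`: the energy measure of `u` is `f dμ` with a function `f ≤ 1`. -/
def EnergyLe (E : DirichletForm μ) (u : C(M, ℝ)) : Prop :=
  ∃ f : M → ℝ≥0∞, Measurable f ∧ (∀ x, f x ≤ 1) ∧ E.IsEnergyMeasure u (μ.withDensity f)

/-- The intrinsic pseudo-distance
`d(x, y) = sup {u(x) - u(y) : u ∈ 𝒟(ℰ) ∩ C⁰(M), dγ(u, u) ≤ dμ}`, with values in `[0, ∞]`
(the function `u = 0` competes, so the supremum is nonnegative). -/
def dist (E : DirichletForm μ) (x y : M) : ℝ≥0∞ :=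
  ⨆ u ∈ {u : C(M, ℝ) | u ∈ E.contDomain ∧ E.EnergyLe u}, ENNReal.ofReal (u x - u y)

/-- The ball `B(x, r)` of the intrinsic distance. -/
def ball (E : DirichletForm μ) (x : M) (r : ℝ) : Set M :=
  {y | E.dist x y < ENNReal.ofReal r}

/-- The intrinsic distance is compatible with the topology of `M`: at each point the balls
are a basis of neighbourhoods. -/
def DistCompatible (E : DirichletForm μ) : Prop :=
  ∀ x : M, (𝓝 x).HasBasis (fun r : ℝ => 0 < r) (fun r => E.ball x r)

/-- The Sobolev exponent `2ν/(ν-2)`. -/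
def sobolevExponent (ν : ℝ) : ℝ≥0∞ := ENNReal.ofReal (2 * ν / (ν - 2))

/-- The Sobolev inequality `‖v‖²_{2ν/(ν-2)} ≤ A ℰ(v) + B ‖v‖²_2` for all `v ∈ 𝒟(ℰ)` with
support in `U`. -/
def SobolevOn (E : DirichletForm μ) (ν : ℝ) (U : Set M) (A B : ℝ) : Prop :=
  ∀ v : E.domain, essSupport μ (v : Lp ℝ 2 μ) ⊆ U →
    eLpNorm (v : Lp ℝ 2 μ) (sobolevExponent ν) μ ^ 2 ≤
      ENNReal.ofReal (A * E.form v v + B * ‖(v : Lp ℝ 2 μ)‖ ^ 2)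

/-- The optimal Sobolev constant `A_opt(U) ∈ [0, ∞]`: the infimum of the `A > 0` for which the
Sobolev inequality holds for functions supported in `U` with some `B > 0`
(`∞` if there is no such `A`). -/
def optSobolev (E : DirichletForm μ) (ν : ℝ) (U : Set M) : ℝ≥0∞ :=
  ⨅ A ∈ {A : ℝ | 0 < A ∧ ∃ B : ℝ, 0 < B ∧ E.SobolevOn ν U A B}, ENNReal.ofReal A

/-- `S(U) = inf {ℰ(u) : u ∈ 𝒟(ℰ), ‖u‖_{2ν/(ν-2)} = 1, supp u ⊆ U} ∈ [0, ∞]`. -/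
def sobolevInv (E : DirichletForm μ) (ν : ℝ) (U : Set M) : ℝ≥0∞ :=
  ⨅ u ∈ {u : E.domain | eLpNorm (u : Lp ℝ 2 μ) (sobolevExponent ν) μ = 1 ∧
      essSupport μ (u : Lp ℝ 2 μ) ⊆ U},
    ENNReal.ofReal (E.form u u)

/-- `ℰ_V(u) = ℰ(u) + ∫ V u² dμ`. -/
def schrodinger (E : DirichletForm μ) (V : M → ℝ) (u : E.domain) : ℝ :=
  E.form u u + ∫ x, V x * (u : Lp ℝ 2 μ) x ^ 2 ∂μ

/-- `Y(U) = inf {ℰ_V(u) : u ∈ 𝒟(ℰ_V), ‖u‖_{2ν/(ν-2)} = 1, supp u ⊆ U} ∈ [-∞, ∞]`, where `𝒟(ℰ_V)`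
consists of the `u ∈ 𝒟(ℰ)` such that `V u²` is integrable. -/
def yamabeInv (E : DirichletForm μ) (ν : ℝ) (V : M → ℝ) (U : Set M) : EReal :=
  ⨅ u ∈ {u : E.domain | Integrable (fun x => V x * (u : Lp ℝ 2 μ) x ^ 2) μ ∧
      eLpNorm (u : Lp ℝ 2 μ) (sobolevExponent ν) μ = 1 ∧
      essSupport μ (u : Lp ℝ 2 μ) ⊆ U},
    (E.schrodinger V u : EReal)

/-- `W` is infinitesimally form bounded: for all `ε > 0` there is `c` such that
`∫ W v² dμ ≤ ε ℰ(v) + c ∫ v² dμ` for all `v ∈ 𝒟(ℰ)`. -/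
def InfFormBounded (E : DirichletForm μ) (W : M → ℝ) : Prop :=
  ∀ ε : ℝ, 0 < ε → ∃ c : ℝ, ∀ v : E.domain,
    Integrable (fun x => W x * (v : Lp ℝ 2 μ) x ^ 2) μ ∧
    ∫ x, W x * (v : Lp ℝ 2 μ) x ^ 2 ∂μ ≤
      ε * E.form v v + c * ∫ x, (v : Lp ℝ 2 μ) x ^ 2 ∂μ

end DirichletForm

end

/-! The core is that local Sobolev inequalities with constant A glue to a global one with the same
A. If ∑ ηᵢ² = 1 with ηᵢ supported in small balls, then v² = ∑ (ηᵢ v)², and Minkowski in L^{q/2}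
gives ‖v‖_q² ≤ ∑ ‖ηᵢ v‖_q². If moreover the energy measures of the ηᵢ are bounded by multiples of μ,
then ∑ ℰ(ηᵢ v) ≤ ℰ(v) + C ‖v‖₂². The error is of L² type, so only B grows (`sum_contForm_mul_le`,
`exists_sobolevOn_univ`). By compactness, such ηᵢ are built from finitely many competitors in the
definition of d (`exists_cutoff`, `exists_partition`).

The required calculus of energy measures is carried out on kernels. The form ℰ is the limit of α⟨f -
αG_α f, g⟩ with α = n + 1, and αG_α preserves positivity. Hence the approximating form is
nonpositive on every kernel ∑ fᵢ(x) gᵢ(y) that is nonnegative and vanishes on the diagonal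
(`kernelForm_nonpos`). Strong locality gives αG_α 1 = 1, which removes the terms depending on one
variable only. The kernel ∑ cᵢ (uᵢ(x) - uᵢ(y))² - (g(x) - g(y))², weighted by φ(x), yields the
contraction properties; (η(x) - η(y))² (v(x) - v(y))² yields the localisation inequality.

For the identities with S and Y: if μ({x}) = 0, Hölder makes ‖u‖₂ as small as desired when ‖u‖_q = 1
and u is supported near x (`exists_ball_norm_sq_le`). The term B ‖u‖₂², and by form boundedness the
potential V, then disappear in the limit of shrinking balls. -/

noncomputable section

open scoped TensorProduct

namespace DirichletForm

/-! ### Resolvents and the approximating forms -/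

section Resolvent

variable {M : Type*} [MeasurableSpace M] {μ : Measure M} [IsFiniteMeasure μ]

theorem form_sq_le (E : DirichletForm μ) (u v : E.domain) :
    E.form u v ^ 2 ≤ E.form u u * E.form v v :=
  E.form.apply_sq_le_of_symm E.nonneg ⟨fun u v => E.symm u v⟩ u v

theorem form_add_self (E : DirichletForm μ) (u v : E.domain) :
    E.form (u + v) (u + v) = E.form u u + 2 * E.form u v + E.form v v := by
  simp only [map_add, LinearMap.add_apply, E.symm v u]
  ring

theorem form_sub_self (E : DirichletForm μ) (u v : E.domain) :
    E.form (u - v) (u - v) = E.form u u - 2 * E.form u v + E.form v v := by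
  simp only [map_sub, LinearMap.sub_apply, E.symm v u]
  ring

theorem tendsto_form_left (E : DirichletForm μ) {u : ℕ → E.domain} {v : E.domain}
    (h : Tendsto (fun n => E.form (u n - v) (u n - v)) atTop (𝓝 0)) (w : E.domain) :
    Tendsto (fun n => E.form (u n) w) atTop (𝓝 (E.form v w)) := by
  have h1 : Tendsto (fun n => E.form (u n - v) w) atTop (𝓝 0) := by
    refine squeeze_zero_norm (a := fun n =>
      Real.sqrt (E.form (u n - v) (u n - v) * E.form w w)) (fun n => ?_) ?_
    · exact Real.abs_le_sqrt (E.form_sq_le _ _)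
    · have := (h.mul_const (E.form w w)).sqrt
      simpa using this
  have h2 := h1.add_const (E.form v w)
  simpa using h2

theorem tendsto_form_self (E : DirichletForm μ) {u : ℕ → E.domain} {v : E.domain}
    (h : Tendsto (fun n => E.form (u n - v) (u n - v)) atTop (𝓝 0)) :
    Tendsto (fun n => E.form (u n) (u n)) atTop (𝓝 (E.form v v)) := by
  have h1 := (h.add ((E.tendsto_form_left h v).const_mul 2)).sub_const (E.form v v)
  refine (h1.congr fun n => ?_).trans (le_of_eq ?_)
  · rw [form_sub_self]; ring
  · congr 1; ring

/-- The functional `ℰ(h) + α ‖h - f‖²`, whose minimiser is the resolvent `α G_α f`. -/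
def penalty (E : DirichletForm μ) (α : ℝ) (f : Lp ℝ 2 μ) (h : E.domain) : ℝ :=
  E.form h h + α * ‖(h : Lp ℝ 2 μ) - f‖ ^ 2

theorem penalty_midpoint (E : DirichletForm μ) (α : ℝ) (f : Lp ℝ 2 μ) (h k : E.domain) :
    E.form (h - k) (h - k) + α * ‖((h - k : E.domain) : Lp ℝ 2 μ)‖ ^ 2 =
      2 * E.penalty α f h + 2 * E.penalty α f k
        - 4 * E.penalty α f ((1 / 2 : ℝ) • (h + k)) := by
  have h1 : (((1 / 2 : ℝ) • (h + k) : E.domain) : Lp ℝ 2 μ) - f =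
      (1 / 2 : ℝ) • (((h : Lp ℝ 2 μ) - f) + ((k : Lp ℝ 2 μ) - f)) := by
    simp only [Submodule.coe_smul, Submodule.coe_add]
    module
  have h2 : ((h - k : E.domain) : Lp ℝ 2 μ) = ((h : Lp ℝ 2 μ) - f) - ((k : Lp ℝ 2 μ) - f) := by
    simp
  have hp := parallelogram_law_with_norm ℝ ((h : Lp ℝ 2 μ) - f) ((k : Lp ℝ 2 μ) - f)
  simp only [penalty, h1, h2, norm_smul, map_smul, LinearMap.smul_apply, form_add_self,
    form_sub_self, smul_eq_mul]
  rw [mul_pow, show ‖(1 / 2 : ℝ)‖ = 1 / 2 by norm_num]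
  linear_combination α * hp

theorem penalty_add (E : DirichletForm μ) (α : ℝ) (f : Lp ℝ 2 μ) (h w : E.domain) :
    E.penalty α f (h + w) = E.penalty α f h
      + 2 * (E.form h w + α * inner ℝ ((h : Lp ℝ 2 μ) - f) (w : Lp ℝ 2 μ))
      + (E.form w w + α * ‖(w : Lp ℝ 2 μ)‖ ^ 2) := by
  have h1 : ((h + w : E.domain) : Lp ℝ 2 μ) - f = ((h : Lp ℝ 2 μ) - f) + w := by
    simp only [Submodule.coe_add]; abel
  simp only [penalty, h1, form_add_self, norm_add_sq_real]
  ring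

theorem penalty_nonneg (E : DirichletForm μ) {α : ℝ} (hα : 0 < α) (f : Lp ℝ 2 μ)
    (h : E.domain) : 0 ≤ E.penalty α f h :=
  add_nonneg (E.nonneg h) (by positivity)

/-- The equation is the Euler equation of `penalty`. A minimising sequence is Cauchy by the
parallelogram identity, and closedness of the form supplies its limit. -/
theorem exists_resolvent (E : DirichletForm μ) {α : ℝ} (hα : 0 < α) (f : Lp ℝ 2 μ) :
    ∃ h : E.domain, ∀ w : E.domain,
      E.form h w + α * inner ℝ ((h : Lp ℝ 2 μ) - f) (w : Lp ℝ 2 μ) = 0 := by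
  set m : ℝ := ⨅ h, E.penalty α f h with hm
  have hbdd : BddBelow (Set.range (E.penalty α f)) :=
    ⟨0, by rintro _ ⟨h, rfl⟩; exact E.penalty_nonneg hα f h⟩
  have hle : ∀ h, m ≤ E.penalty α f h := fun h => ciInf_le hbdd h
  have hex : ∀ n : ℕ, ∃ h, E.penalty α f h < m + 1 / ((n : ℝ) + 1) := fun n =>
    exists_lt_of_ciInf_lt (lt_add_of_pos_right m Nat.one_div_pos_of_nat)
  choose u hu using hex
  have hlim : Tendsto (fun n : ℕ => 1 / ((n : ℝ) + 1)) atTop (𝓝 0) :=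
    tendsto_one_div_add_atTop_nhds_zero_nat
  have hcau : ∀ k n : ℕ, E.form (u k - u n) (u k - u n)
      + α * ‖((u k - u n : E.domain) : Lp ℝ 2 μ)‖ ^ 2 ≤
      2 * (1 / ((k : ℝ) + 1)) + 2 * (1 / ((n : ℝ) + 1)) := by
    intro k n
    rw [E.penalty_midpoint α f]
    linarith [hu k, hu n, hle ((1 / 2 : ℝ) • (u k + u n))]
  obtain ⟨v, hv⟩ := E.closed u (by
    intro ε hε
    have hδ : 0 < ε / (4 * (1 + 1 / α)) := by positivity
    obtain ⟨N, hN⟩ := eventually_atTop.1 (hlim.eventually (gt_mem_nhds hδ))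
    refine ⟨N, fun k hk n hn => ?_⟩
    have h1 := hcau k n
    have h2 := hN k hk
    have h3 := hN n hn
    have hE := E.nonneg (u k - u n)
    set a := E.form (u k - u n) (u k - u n)
    set b := ‖((u k - u n : E.domain) : Lp ℝ 2 μ)‖ ^ 2 with hb
    have hb0 : 0 ≤ b := by positivity
    -- The factor 1 + 1/α compares the two norms for small and for large α at once.
    have h4 : a + b ≤ (1 + 1 / α) * (a + α * b) := by
      have : (1 + 1 / α) * (a + α * b) = a + b + (α * b + 1 / α * a) := by
        field_simp; ring
      rw [this]
      have : 0 ≤ α * b + 1 / α * a := by positivity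
      linarith
    have h5 : a + α * b < ε / (1 + 1 / α) := by
      have : ε / (1 + 1 / α) = 4 * (ε / (4 * (1 + 1 / α))) := by field_simp
      rw [this]; linarith
    calc a + b ≤ (1 + 1 / α) * (a + α * b) := h4
      _ < (1 + 1 / α) * (ε / (1 + 1 / α)) := by gcongr
      _ = ε := by field_simp)
  refine ⟨v, fun w => ?_⟩
  have hv1 : Tendsto (fun n => E.form (u n - v) (u n - v)) atTop (𝓝 0) :=
    squeeze_zero (fun n => E.nonneg _) (fun n => le_add_of_nonneg_right (sq_nonneg _)) hv
  have hv2 : Tendsto (fun n => (u n : Lp ℝ 2 μ)) atTop (𝓝 v) := by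
    have h1 : Tendsto (fun n => ‖((u n - v : E.domain) : Lp ℝ 2 μ)‖ ^ 2) atTop (𝓝 0) :=
      squeeze_zero (fun n => sq_nonneg _) (fun n => le_add_of_nonneg_left (E.nonneg _)) hv
    have h2 := h1.sqrt
    simp only [Real.sqrt_sq (norm_nonneg _), Real.sqrt_zero, Submodule.coe_sub] at h2
    exact tendsto_iff_norm_sub_tendsto_zero.2 h2
  have hb : Tendsto (fun n => E.form (u n) w
      + α * inner ℝ ((u n : Lp ℝ 2 μ) - f) (w : Lp ℝ 2 μ)) atTop
      (𝓝 (E.form v w + α * inner ℝ ((v : Lp ℝ 2 μ) - f) (w : Lp ℝ 2 μ))) :=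
    (E.tendsto_form_left hv1 w).add
      (((hv2.sub_const f).inner tendsto_const_nhds).const_mul α)
  have hb0 : Tendsto (fun n => E.form (u n) w
      + α * inner ℝ ((u n : Lp ℝ 2 μ) - f) (w : Lp ℝ 2 μ)) atTop (𝓝 0) := by
    set c := E.form w w + α * ‖(w : Lp ℝ 2 μ)‖ ^ 2 with hc
    refine squeeze_zero_norm (a := fun n : ℕ => Real.sqrt (c * (1 / ((n : ℝ) + 1))))
      (fun n => Real.abs_le_sqrt ?_) ?_
    -- Since `u n` minimises up to 1/(n+1), this quadratic in t is nonnegative; its discriminant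
    -- bounds the first variation at `u n`, which therefore tends to 0.
    · have hq : ∀ t : ℝ, 0 ≤ c * (t * t)
          + 2 * (E.form (u n) w + α * inner ℝ ((u n : Lp ℝ 2 μ) - f) (w : Lp ℝ 2 μ)) * t
          + 1 / ((n : ℝ) + 1) := by
        intro t
        have h1 := hle (u n + t • w)
        rw [penalty_add] at h1
        simp only [map_smul, LinearMap.smul_apply, smul_eq_mul, Submodule.coe_smul,
          inner_smul_right, norm_smul, mul_pow, Real.norm_eq_abs, sq_abs] at h1
        rw [hc]
        nlinarith [hu n]
      have h2 := discrim_le_zero hq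
      rw [discrim] at h2
      linarith
    · have := (hlim.const_mul c).sqrt
      simpa using this
  exact tendsto_nhds_unique hb hb0

theorem resolvent_unique (E : DirichletForm μ) {α : ℝ} (hα : 0 < α) {f : Lp ℝ 2 μ}
    {h k : E.domain}
    (hh : ∀ w : E.domain, E.form h w + α * inner ℝ ((h : Lp ℝ 2 μ) - f) (w : Lp ℝ 2 μ) = 0)
    (hk : ∀ w : E.domain, E.form k w + α * inner ℝ ((k : Lp ℝ 2 μ) - f) (w : Lp ℝ 2 μ) = 0) :
    h = k := by
  have h1 := hh (h - k)
  have h2 := hk (h - k)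
  have h3 : E.form (h - k) (h - k) + α * ‖((h - k : E.domain) : Lp ℝ 2 μ)‖ ^ 2 = 0 := by
    rw [← real_inner_self_eq_norm_sq]
    have hs : E.form (h - k) (h - k) = E.form h (h - k) - E.form k (h - k) := by
      rw [map_sub E.form h k, LinearMap.sub_apply]
    rw [hs]
    have : inner ℝ ((h - k : E.domain) : Lp ℝ 2 μ) ((h - k : E.domain) : Lp ℝ 2 μ) =
        inner ℝ ((h : Lp ℝ 2 μ) - f) ((h - k : E.domain) : Lp ℝ 2 μ)
        - inner ℝ ((k : Lp ℝ 2 μ) - f) ((h - k : E.domain) : Lp ℝ 2 μ) := by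
      rw [← inner_sub_left]
      congr 1
      simp
    rw [this]
    linarith
  have h4 := E.nonneg (h - k)
  have h5 : ‖((h - k : E.domain) : Lp ℝ 2 μ)‖ ^ 2 = 0 := by
    have : 0 ≤ ‖((h - k : E.domain) : Lp ℝ 2 μ)‖ ^ 2 := by positivity
    nlinarith
  have h6 : ((h - k : E.domain) : Lp ℝ 2 μ) = 0 := by simpa using h5
  exact sub_eq_zero.1 (Subtype.ext h6)

/-- The resolvent operators `α G_α` of the form, for `α = n + 1`. -/
def approx (E : DirichletForm μ) (n : ℕ) : Lp ℝ 2 μ →ₗ[ℝ] E.domain where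
  toFun f := (E.exists_resolvent n.cast_add_one_pos f).choose
  map_add' f g := by
    refine E.resolvent_unique n.cast_add_one_pos
      (E.exists_resolvent n.cast_add_one_pos (f + g)).choose_spec fun w => ?_
    have h1 := (E.exists_resolvent n.cast_add_one_pos f).choose_spec w
    have h2 := (E.exists_resolvent n.cast_add_one_pos g).choose_spec w
    rw [inner_sub_left] at h1 h2 ⊢
    simp only [map_add, LinearMap.add_apply, Submodule.coe_add, inner_add_left]
    linarith
  map_smul' c f := by
    refine E.resolvent_unique n.cast_add_one_pos
      (E.exists_resolvent n.cast_add_one_pos (c • f)).choose_spec fun w => ?_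
    have h1 := (E.exists_resolvent n.cast_add_one_pos f).choose_spec w
    rw [inner_sub_left] at h1 ⊢
    simp only [map_smul, LinearMap.smul_apply, Submodule.coe_smul, real_inner_smul_left,
      smul_eq_mul, RingHom.id_apply]
    linear_combination c * h1

theorem approx_spec (E : DirichletForm μ) (n : ℕ) (f : Lp ℝ 2 μ) (w : E.domain) :
    E.form (E.approx n f) w
      + (n + 1) * inner ℝ ((E.approx n f : Lp ℝ 2 μ) - f) (w : Lp ℝ 2 μ) = 0 :=
  (E.exists_resolvent n.cast_add_one_pos f).choose_spec w

theorem approx_unique (E : DirichletForm μ) (n : ℕ) {f : Lp ℝ 2 μ} {h : E.domain}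
    (hh : ∀ w : E.domain,
      E.form h w + (n + 1) * inner ℝ ((h : Lp ℝ 2 μ) - f) (w : Lp ℝ 2 μ) = 0) :
    E.approx n f = h :=
  E.resolvent_unique n.cast_add_one_pos (E.approx_spec n f) hh

/-- Completing the square: the Euler equation kills the cross term, so the excess over the minimum
is an exact quadratic expression. -/
theorem penalty_eq_approx (E : DirichletForm μ) (n : ℕ) (f : Lp ℝ 2 μ) (h : E.domain) :
    E.penalty (n + 1) f h = E.penalty (n + 1) f (E.approx n f)
      + (E.form (h - E.approx n f) (h - E.approx n f)
        + (n + 1) * ‖((h - E.approx n f : E.domain) : Lp ℝ 2 μ)‖ ^ 2) := by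
  have h1 := E.penalty_add (n + 1) f (E.approx n f) (h - E.approx n f)
  rw [E.approx_spec, add_sub_cancel] at h1
  linarith

/-- For f ≥ 0, replacing the minimiser by its absolute value increases neither term of the penalty,
so by uniqueness the two agree. -/
theorem approx_nonneg (E : DirichletForm μ) (n : ℕ) {f : Lp ℝ 2 μ} (hf : 0 ≤ f) :
    0 ≤ (E.approx n f : Lp ℝ 2 μ) := by
  obtain ⟨h, hle⟩ := E.markov_abs (E.approx n f)
  set k : E.domain := ⟨|(E.approx n f : Lp ℝ 2 μ)|, h⟩ with hk
  have h1 := E.penalty_eq_approx n f k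
  have h2 : ‖(k : Lp ℝ 2 μ) - f‖ ≤ ‖(E.approx n f : Lp ℝ 2 μ) - f‖ := by
    refine norm_le_norm_of_abs_le_abs ?_
    calc |(k : Lp ℝ 2 μ) - f| = |(|(E.approx n f : Lp ℝ 2 μ)| - |f|)| := by
          rw [abs_of_nonneg hf]
      _ ≤ _ := abs_abs_sub_abs_le _ _
  have h3 : E.penalty (n + 1) f k ≤ E.penalty (n + 1) f (E.approx n f) := by
    unfold penalty
    gcongr
  have h4 := E.nonneg (k - E.approx n f)
  have h5 : ‖((k - E.approx n f : E.domain) : Lp ℝ 2 μ)‖ ^ 2 = 0 := by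
    have : 0 ≤ ‖((k - E.approx n f : E.domain) : Lp ℝ 2 μ)‖ ^ 2 := by positivity
    nlinarith [(n.cast_add_one_pos : (0 : ℝ) < n + 1)]
  have h6 : (k : Lp ℝ 2 μ) - (E.approx n f : Lp ℝ 2 μ) = 0 := by simpa using h5
  rw [← sub_eq_zero.1 h6]
  exact abs_nonneg _

theorem norm_approx_le (E : DirichletForm μ) (n : ℕ) (f : Lp ℝ 2 μ) :
    ‖(E.approx n f : Lp ℝ 2 μ)‖ ≤ ‖f‖ := by
  have h1 := E.approx_spec n f (E.approx n f)
  rw [inner_sub_left, real_inner_self_eq_norm_sq] at h1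
  have h2 := E.nonneg (E.approx n f)
  have h3 := real_inner_le_norm f (E.approx n f : Lp ℝ 2 μ)
  have h4 : ‖(E.approx n f : Lp ℝ 2 μ)‖ ^ 2 ≤ inner ℝ f (E.approx n f : Lp ℝ 2 μ) := by
    nlinarith [(n.cast_add_one_pos : (0 : ℝ) < n + 1)]
  by_contra! h
  nlinarith [norm_nonneg f]

/-- The approximating forms `α ⟨f - α G_α f, g⟩` for `α = n + 1`. -/
def approxForm (E : DirichletForm μ) (n : ℕ) (f g : Lp ℝ 2 μ) : ℝ :=
  (n + 1) * inner ℝ (f - (E.approx n f : Lp ℝ 2 μ)) g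

theorem approxForm_coe_right (E : DirichletForm μ) (n : ℕ) (f : Lp ℝ 2 μ) (w : E.domain) :
    E.approxForm n f w = E.form (E.approx n f) w := by
  have h1 := E.approx_spec n f w
  rw [← neg_sub, inner_neg_left] at h1
  rw [approxForm]
  linarith

theorem approxForm_comm (E : DirichletForm μ) (n : ℕ) (f g : Lp ℝ 2 μ) :
    E.approxForm n f g = E.approxForm n g f := by
  have h1 := E.approx_spec n f (E.approx n g)
  have h2 := E.approx_spec n g (E.approx n f)
  rw [E.symm, inner_sub_left] at h2
  rw [inner_sub_left] at h1
  rw [approxForm, approxForm, inner_sub_left, inner_sub_left, real_inner_comm f g]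
  rw [real_inner_comm (E.approx n g : Lp ℝ 2 μ) (E.approx n f : Lp ℝ 2 μ)] at h1
  rw [real_inner_comm _ f, real_inner_comm _ g] at *
  linarith

/-- Thus the approximating form is the minimum of the penalty, and any competitor bounds it from
above. -/
theorem approxForm_self (E : DirichletForm μ) (n : ℕ) (f : Lp ℝ 2 μ) :
    E.approxForm n f f = E.penalty (n + 1) f (E.approx n f) := by
  have h1 := E.approxForm_coe_right n f (E.approx n f)
  rw [penalty, ← h1, approxForm, approxForm, norm_sub_rev, ← real_inner_self_eq_norm_sq,
    inner_sub_right (f - _)]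
  ring

theorem approxForm_self_le (E : DirichletForm μ) (n : ℕ) (u : E.domain) :
    E.approxForm n u u ≤ E.form u u := by
  rw [approxForm_self]
  have h := E.penalty_eq_approx n (u : Lp ℝ 2 μ) u
  have h0 : E.penalty (n + 1) (u : Lp ℝ 2 μ) u = E.form u u := by simp [penalty]
  have h1 := E.nonneg (u - E.approx n u)
  have h2 : 0 ≤ (n + 1) * ‖((u - E.approx n u : E.domain) : Lp ℝ 2 μ)‖ ^ 2 := by positivity
  linarith

/-- Each minimiser competes in the other's problem. Adding the two comparisons shows that the
distance to f decreases in n; the comparison at parameter k then gives the energy gap. -/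
theorem approx_mono (E : DirichletForm μ) (f : Lp ℝ 2 μ) {k n : ℕ} (hkn : k ≤ n) :
    E.form (E.approx n f - E.approx k f) (E.approx n f - E.approx k f) ≤
      E.form (E.approx n f) (E.approx n f) - E.form (E.approx k f) (E.approx k f) := by
  rcases hkn.eq_or_lt with rfl | hlt
  · simp
  have h1 := E.penalty_eq_approx k f (E.approx n f)
  have h2 := E.penalty_eq_approx n f (E.approx k f)
  have e1 := E.nonneg (E.approx n f - E.approx k f)
  have e2 := E.nonneg (E.approx k f - E.approx n f)
  unfold penalty at h1 h2
  have hkn' : (k : ℝ) < n := by exact_mod_cast hlt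
  have p1 : 0 ≤ ‖((E.approx n f - E.approx k f : E.domain) : Lp ℝ 2 μ)‖ ^ 2 := by positivity
  have p2 : 0 ≤ ‖((E.approx k f - E.approx n f : E.domain) : Lp ℝ 2 μ)‖ ^ 2 := by positivity
  have hk0 : (0 : ℝ) ≤ k := k.cast_nonneg
  have q1 := mul_nonneg (by positivity : (0 : ℝ) ≤ (k : ℝ) + 1) p1
  have q2 := mul_nonneg (by positivity : (0 : ℝ) ≤ (n : ℝ) + 1) p2
  set a := ‖(E.approx n f : Lp ℝ 2 μ) - f‖ ^ 2
  set b := ‖(E.approx k f : Lp ℝ 2 μ) - f‖ ^ 2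
  have hab : a ≤ b := by nlinarith
  nlinarith

/-- The criterion by which new functions enter the domain. The bound forces αG_α f → f in L², while
the energies increase and stay bounded, so by `approx_mono` the sequence is Cauchy for the form. -/
theorem exists_domain_of_bounded (E : DirichletForm μ) (f : Lp ℝ 2 μ) {C : ℝ}
    (hC : ∀ n, E.approxForm n f f ≤ C) :
    ∃ v : E.domain, (v : Lp ℝ 2 μ) = f ∧
      Tendsto (fun n => E.form (E.approx n f - v) (E.approx n f - v)) atTop (𝓝 0) := by
  have hC' : ∀ n, E.form (E.approx n f) (E.approx n f)
      + ((n : ℝ) + 1) * ‖(E.approx n f : Lp ℝ 2 μ) - f‖ ^ 2 ≤ C := fun n => by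
    have := hC n
    rwa [approxForm_self] at this
  have hb : ∀ n, ‖(E.approx n f : Lp ℝ 2 μ) - f‖ ^ 2 ≤ C * (1 / ((n : ℝ) + 1)) := by
    intro n
    have h1 := hC' n
    have h2 := E.nonneg (E.approx n f)
    rw [mul_one_div, le_div_iff₀ n.cast_add_one_pos]
    linarith
  have hL2 : Tendsto (fun n => (E.approx n f : Lp ℝ 2 μ)) atTop (𝓝 f) := by
    have h1 : Tendsto (fun n => ‖(E.approx n f : Lp ℝ 2 μ) - f‖ ^ 2) atTop (𝓝 0) :=
      squeeze_zero (fun n => sq_nonneg _) hb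
        (by simpa using tendsto_one_div_add_atTop_nhds_zero_nat.const_mul C)
    have h2 := h1.sqrt
    simp only [Real.sqrt_sq (norm_nonneg _), Real.sqrt_zero] at h2
    exact tendsto_iff_norm_sub_tendsto_zero.2 h2
  have hmono : Monotone fun n => E.form (E.approx n f) (E.approx n f) := fun k n hkn => by
    have h1 := E.approx_mono f hkn
    have h2 := E.nonneg (E.approx n f - E.approx k f)
    simp only
    linarith
  have hbdd : BddAbove (Set.range fun n => E.form (E.approx n f) (E.approx n f)) :=
    ⟨C, by
      rintro _ ⟨n, rfl⟩
      have h1 := hC' n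
      have : 0 ≤ ((n : ℝ) + 1) * ‖(E.approx n f : Lp ℝ 2 μ) - f‖ ^ 2 := by positivity
      simp only
      linarith⟩
  have hcE := (tendsto_atTop_ciSup hmono hbdd).cauchySeq
  obtain ⟨v, hv⟩ := E.closed (fun n => E.approx n f) (by
    intro ε hε
    obtain ⟨N₁, hN₁⟩ := Metric.cauchySeq_iff.1 hcE (ε / 2) (by positivity)
    obtain ⟨N₂, hN₂⟩ := Metric.cauchySeq_iff.1 hL2.cauchySeq (Real.sqrt (ε / 2)) (by positivity)
    refine ⟨max N₁ N₂, fun k hk n hn => ?_⟩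
    have h1 := hN₁ k (le_trans (le_max_left _ _) hk) n (le_trans (le_max_left _ _) hn)
    have h2 := hN₂ k (le_trans (le_max_right _ _) hk) n (le_trans (le_max_right _ _) hn)
    rw [Real.dist_eq] at h1
    rw [dist_eq_norm, Real.lt_sqrt (norm_nonneg _)] at h2
    have h3 : E.form (E.approx k f - E.approx n f) (E.approx k f - E.approx n f) < ε / 2 := by
      rcases le_total n k with h | h
      · exact (E.approx_mono f h).trans_lt ((le_abs_self _).trans_lt h1)
      · have := E.approx_mono f h
        rw [E.form_sub_self] at this ⊢
        rw [E.symm (E.approx n f) (E.approx k f)] at this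
        rw [abs_lt] at h1
        linarith
    rw [Submodule.coe_sub]
    linarith)
  refine ⟨v, ?_, squeeze_zero (fun n => E.nonneg _)
    (fun n => le_add_of_nonneg_right (sq_nonneg _)) hv⟩
  have h1 : Tendsto (fun n => ‖((E.approx n f - v : E.domain) : Lp ℝ 2 μ)‖ ^ 2) atTop (𝓝 0) :=
    squeeze_zero (fun n => sq_nonneg _) (fun n => le_add_of_nonneg_left (E.nonneg _)) hv
  have h2 := h1.sqrt
  simp only [Real.sqrt_sq (norm_nonneg _), Real.sqrt_zero, Submodule.coe_sub] at h2
  exact tendsto_nhds_unique (tendsto_iff_norm_sub_tendsto_zero.2 h2) hL2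

theorem tendsto_approxForm (E : DirichletForm μ) (u v : E.domain) :
    Tendsto (fun n => E.approxForm n u v) atTop (𝓝 (E.form u v)) := by
  obtain ⟨u', hu', h⟩ := E.exists_domain_of_bounded (u : Lp ℝ 2 μ) fun n => E.approxForm_self_le n u
  obtain rfl : u' = u := Subtype.ext hu'
  simpa only [approxForm_coe_right] using E.tendsto_form_left h v

end Resolvent

end DirichletForm

theorem MeasureTheory.L2.inner_nonneg_of_nonneg {M : Type*} [MeasurableSpace M]
    {μ : Measure M} {f g : Lp ℝ 2 μ} (hf : 0 ≤ f) (hg : 0 ≤ g) :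
    0 ≤ inner ℝ f g := by
  rw [L2.inner_def]
  refine integral_nonneg_of_ae ?_
  filter_upwards [(Lp.coeFn_nonneg f).2 hf, (Lp.coeFn_nonneg g).2 hg] with x hx hy
  simpa using mul_nonneg hy hx


/-! ### Positivity on kernels -/

section Kernel

variable {M : Type*} [TopologicalSpace M]

/-- The value at `(x, y)` of the kernel represented by an element of `C⁰(M) ⊗ C⁰(M)`. -/
def evalKernel (x y : M) : C(M, ℝ) ⊗[ℝ] C(M, ℝ) →ₐ[ℝ] ℝ :=
  Algebra.TensorProduct.productMap (ContinuousMap.evalAlgHom ℝ ℝ x)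
    (ContinuousMap.evalAlgHom ℝ ℝ y)

@[simp]
theorem evalKernel_tmul (x y : M) (f g : C(M, ℝ)) :
    evalKernel x y (f ⊗ₜ g) = f x * g y := by
  simp [evalKernel]

/-- The kernel `f(x) - f(y)`. -/
def diffKernel (f : C(M, ℝ)) : C(M, ℝ) ⊗[ℝ] C(M, ℝ) := f ⊗ₜ 1 - 1 ⊗ₜ f

@[simp]
theorem evalKernel_diffKernel (x y : M) (f : C(M, ℝ)) :
    evalKernel x y (diffKernel f) = f x - f y := by
  simp [diffKernel]

theorem diffKernel_sq (f : C(M, ℝ)) :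
    diffKernel f ^ 2 = (f * f) ⊗ₜ 1 - (2 : ℝ) • (f ⊗ₜ f) + 1 ⊗ₜ (f * f) := by
  simp only [diffKernel, pow_two, sub_mul, mul_sub, Algebra.TensorProduct.tmul_mul_tmul, mul_one,
    one_mul]
  module

variable [CompactSpace M]

/-- A single partition of unity, subordinate to sets on which all the functions oscillate by less
than ε, serves the whole finite family. -/
theorem ContinuousMap.exists_norm_sub_sum_smul_le [T2Space M] {ι : Type*} [Finite ι]
    (f : ι → C(M, ℝ)) {ε : ℝ} (hε : 0 < ε) :
    ∃ (t : Finset M) (ρ : t → C(M, ℝ)), (∀ j, 0 ≤ ρ j) ∧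
      ∀ i, ‖f i - ∑ j : t, f i j • ρ j‖ ≤ ε := by
  let U : M → Set M := fun x => {y | ∀ i, |f i y - f i x| < ε}
  have hU : ∀ x, IsOpen (U x) := fun x => by
    simp only [U, Set.ofPred_forall]
    exact isOpen_iInter_of_finite fun i =>
      isOpen_lt (((f i).continuous.sub continuous_const).abs) continuous_const
  obtain ⟨t, ht⟩ := isCompact_univ.elim_finite_subcover U hU
    fun x _ => Set.mem_iUnion.2 ⟨x, fun i => by simpa using hε⟩
  obtain ⟨ρ, hρ⟩ := PartitionOfUnity.exists_isSubordinate isClosed_univ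
    (fun j : t => U j) (fun j => hU j) (by
      intro x hx
      obtain ⟨y, hy, hxy⟩ := Set.mem_iUnion₂.1 (ht hx)
      exact Set.mem_iUnion.2 ⟨⟨y, hy⟩, hxy⟩)
  refine ⟨t, fun j => ρ j, fun j => ρ.nonneg j, fun i => ?_⟩
  refine (ContinuousMap.norm_le _ hε.le).2 fun x => ?_
  have h1 : ∑ j : t, ρ j x = 1 := by
    rw [← finsum_eq_sum_of_fintype]
    exact ρ.sum_eq_one (Set.mem_univ x)
  have h2 : (f i - ∑ j : t, f i j • ρ j) x = ∑ j : t, ρ j x * (f i x - f i j) := by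
    simp only [ContinuousMap.sub_apply, ContinuousMap.sum_apply, ContinuousMap.smul_apply,
      smul_eq_mul, mul_sub, Finset.sum_sub_distrib, ← Finset.sum_mul, h1, one_mul]
    congr 1
    exact Finset.sum_congr rfl fun j _ => mul_comm _ _
  rw [h2]
  calc ‖∑ j : t, ρ j x * (f i x - f i j)‖ ≤ ∑ j : t, ‖ρ j x * (f i x - f i j)‖ :=
        norm_sum_le _ _
    _ ≤ ∑ j : t, ρ j x * ε := by
        refine Finset.sum_le_sum fun j _ => ?_
        rw [norm_mul, Real.norm_of_nonneg (ρ.nonneg j x)]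
        by_cases hx : ρ j x = 0
        · simp [hx]
        · exact mul_le_mul_of_nonneg_left (hρ j (subset_tsupport _ hx) i).le (ρ.nonneg j x)
    _ = ε := by rw [← Finset.sum_mul, h1, one_mul]

/-- A positive continuous bilinear form on `C⁰(M)` is nonnegative on kernels
`∑ fᵢ(x) gᵢ(y)` which are pointwise nonnegative. -/
theorem sum_bilin_nonneg [T2Space M] (β : C(M, ℝ) →L[ℝ] C(M, ℝ) →L[ℝ] ℝ)
    (hβ : ∀ f g : C(M, ℝ), 0 ≤ f → 0 ≤ g → 0 ≤ β f g) {ι : Type*} [Fintype ι]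
    (f g : ι → C(M, ℝ)) (h : ∀ x y, 0 ≤ ∑ i, f i x * g i y) :
    0 ≤ ∑ i, β (f i) (g i) := by
  have hex : ∀ n : ℕ, ∃ F G : ι → C(M, ℝ), (∀ i, ‖f i - F i‖ ≤ 1 / ((n : ℝ) + 1)) ∧
      (∀ i, ‖g i - G i‖ ≤ 1 / ((n : ℝ) + 1)) ∧ 0 ≤ ∑ i, β (F i) (G i) := by
    intro n
    obtain ⟨t, ρ, hρ, ht⟩ := ContinuousMap.exists_norm_sub_sum_smul_le
      (Sum.elim f g) (Nat.one_div_pos_of_nat (α := ℝ) (n := n))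
    refine ⟨fun i => ∑ j : t, f i j • ρ j, fun i => ∑ j : t, g i j • ρ j,
      fun i => ht (Sum.inl i), fun i => ht (Sum.inr i), ?_⟩
    -- After discretisation the coefficients are the values of the kernel at pairs of nodes, which
    -- are nonnegative by hypothesis.
    have hsum : ∑ i, β (∑ j : t, f i j • ρ j) (∑ j : t, g i j • ρ j) =
        ∑ j : t, ∑ k : t, (∑ i, f i j * g i k) * β (ρ j) (ρ k) := by
      simp only [map_sum, map_smul, sum_apply, smul_apply,
        smul_eq_mul, Finset.sum_mul, Finset.mul_sum]
      rw [Finset.sum_comm]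
      simp_rw [Finset.sum_comm (s := (Finset.univ : Finset ι))]
      rw [Finset.sum_comm]
      refine Finset.sum_congr rfl fun j _ => Finset.sum_congr rfl fun k _ =>
        Finset.sum_congr rfl fun i _ => by ring
    rw [hsum]
    exact Finset.sum_nonneg fun j _ => Finset.sum_nonneg fun k _ =>
      mul_nonneg (h j k) (hβ _ _ (hρ j) (hρ k))
  choose F G hF hG hFG using hex
  have key : ∀ (u : C(M, ℝ)) (v : ℕ → C(M, ℝ)), (∀ n : ℕ, ‖u - v n‖ ≤ 1 / ((n : ℝ) + 1)) →
      Tendsto v atTop (𝓝 u) := fun u v huv =>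
    tendsto_iff_norm_sub_tendsto_zero.2 (squeeze_zero (fun _ => norm_nonneg _)
      (fun n => by rw [norm_sub_rev]; exact huv n) tendsto_one_div_add_atTop_nhds_zero_nat)
  have hlim : Tendsto (fun n => ∑ i, β (F n i) (G n i)) atTop (𝓝 (∑ i, β (f i) (g i))) :=
    tendsto_finsetSum _ fun i _ =>
      (β.continuous₂.tendsto (f i, g i)).comp
        ((key _ _ fun n => hF n i).prodMk_nhds (key _ _ fun n => hG n i))
  exact ge_of_tendsto' hlim hFG

variable [MeasurableSpace M] [BorelSpace M] {μ : Measure M} [IsFiniteMeasure μ]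

namespace DirichletForm

/-- The approximating form as a linear functional on kernels. -/
def kernelForm (E : DirichletForm μ) (n : ℕ) : C(M, ℝ) ⊗[ℝ] C(M, ℝ) →ₗ[ℝ] ℝ :=
  TensorProduct.lift (LinearMap.mk₂ ℝ
    (fun f g => E.approxForm n (ContinuousMap.toLp 2 μ ℝ f) (ContinuousMap.toLp 2 μ ℝ g))
    (fun f₁ f₂ g => by
      simp only [approxForm, map_add, Submodule.coe_add, inner_sub_left, inner_add_left]; ring)
    (fun c f g => by
      simp only [approxForm, map_smul, Submodule.coe_smul, inner_sub_left, real_inner_smul_left,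
        smul_eq_mul]; ring)
    (fun f g₁ g₂ => by simp only [approxForm, map_add, inner_add_right]; ring)
    (fun c f g => by simp only [approxForm, map_smul, inner_smul_right, smul_eq_mul]; ring))

@[simp]
theorem kernelForm_tmul (E : DirichletForm μ) (n : ℕ) (f g : C(M, ℝ)) :
    E.kernelForm n (f ⊗ₜ g) =
      E.approxForm n (ContinuousMap.toLp 2 μ ℝ f) (ContinuousMap.toLp 2 μ ℝ g) := rfl

theorem toLp_nonneg {f : C(M, ℝ)} (hf : 0 ≤ f) : 0 ≤ ContinuousMap.toLp 2 μ ℝ f := by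
  rw [← Lp.coeFn_nonneg]
  filter_upwards [ContinuousMap.coeFn_toLp (p := 2) μ (𝕜 := ℝ) f] with x hx
  rw [hx]
  exact hf x

theorem inner_toLp_eq_integral (f g : C(M, ℝ)) :
    inner ℝ (ContinuousMap.toLp 2 μ ℝ f) (ContinuousMap.toLp 2 μ ℝ g) = ∫ x, f x * g x ∂μ := by
  rw [ContinuousMap.inner_toLp]
  simp [mul_comm]

theorem _root_.ContinuousMap.integrable_of_compactSpace (f : C(M, ℝ)) : Integrable f μ :=
  Integrable.of_bound f.continuous.aestronglyMeasurable ‖f‖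
    (ae_of_all _ f.norm_coe_le_norm)

/-- The approximating forms are nonpositive on nonnegative kernels vanishing on the diagonal. -/
theorem kernelForm_nonpos [T2Space M] (E : DirichletForm μ) (n : ℕ)
    (t : C(M, ℝ) ⊗[ℝ] C(M, ℝ)) (hpos : ∀ x y, 0 ≤ evalKernel x y t)
    (hdiag : ∀ x, evalKernel x x t = 0) : E.kernelForm n t ≤ 0 := by
  obtain ⟨k, f, g, rfl⟩ := TensorProduct.exists_sum_tmul_eq t
  simp only [map_sum, evalKernel_tmul, kernelForm_tmul] at *
  -- The approximating form splits as α(⟨f, g⟩ - ⟨αG_α f, g⟩). The first part sees only the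
  -- diagonal, so it vanishes; the second is a positive bilinear form β.
  let P : Lp ℝ 2 μ →L[ℝ] Lp ℝ 2 μ :=
    (E.domain.subtype ∘ₗ E.approx n).mkContinuous 1 fun f => by
      simpa using E.norm_approx_le n f
  let J : C(M, ℝ) →L[ℝ] Lp ℝ 2 μ := ContinuousMap.toLp 2 μ ℝ
  let β : C(M, ℝ) →L[ℝ] C(M, ℝ) →L[ℝ] ℝ :=
    ((innerSL ℝ).bilinearComp (P ∘L J) J : C(M, ℝ) →L[ℝ] C(M, ℝ) →L[ℝ] ℝ)
  have hβ : ∀ f g, β f g = inner ℝ (E.approx n (J f) : Lp ℝ 2 μ) (J g) := fun f g => rfl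
  have h1 := sum_bilin_nonneg β (fun f g hf hg => by
    rw [hβ]
    exact L2.inner_nonneg_of_nonneg (E.approx_nonneg n (toLp_nonneg hf)) (toLp_nonneg hg)) f g hpos
  have h2 : ∑ i, inner ℝ (J (f i)) (J (g i)) = 0 := by
    simp only [J, inner_toLp_eq_integral]
    rw [← integral_finsetSum _ fun i _ =>
      (show Integrable (fun x => f i x * g i x) μ from (f i * g i).integrable_of_compactSpace)]
    simp [hdiag]
  have h3 : ∑ i, E.approxForm n (J (f i)) (J (g i)) =
      (n + 1) * (∑ i, inner ℝ (J (f i)) (J (g i)) - ∑ i, β (f i) (g i)) := by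
    simp only [approxForm, inner_sub_left, hβ, ← Finset.sum_sub_distrib, Finset.mul_sum]
  change ∑ i, E.approxForm n (J (f i)) (J (g i)) ≤ 0
  rw [h3, h2, zero_sub]
  exact mul_nonpos_of_nonneg_of_nonpos (by positivity) (neg_nonpos.2 h1)

end DirichletForm

end Kernel

namespace DirichletForm

/-! ### Energy measures: contraction and localisation -/

section EnergyFunctional

variable {M : Type*} [TopologicalSpace M] [CompactSpace M] [MeasurableSpace M] [BorelSpace M]
  {μ : Measure M} [IsFiniteMeasure μ] {E : DirichletForm μ}

/-- The form on continuous functions of the domain, extended by the junk value `0`. -/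
def contForm (E : DirichletForm μ) (f g : C(M, ℝ)) : ℝ :=
  open Classical in
  if h : f ∈ E.contDomain ∧ g ∈ E.contDomain then E.form ⟨_, h.1⟩ ⟨_, h.2⟩ else 0

theorem contForm_eq {f g : C(M, ℝ)} (hf : f ∈ E.contDomain) (hg : g ∈ E.contDomain) :
    E.contForm f g = E.form ⟨_, hf⟩ ⟨_, hg⟩ :=
  dif_pos ⟨hf, hg⟩

theorem contForm_self_nonneg (f : C(M, ℝ)) : 0 ≤ E.contForm f f := by
  unfold contForm
  split_ifs
  · exact E.nonneg _
  · exact le_rfl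

theorem tendsto_kernelForm_tmul {f g : C(M, ℝ)} (hf : f ∈ E.contDomain) (hg : g ∈ E.contDomain) :
    Tendsto (fun n => E.kernelForm n (f ⊗ₜ g)) atTop (𝓝 (E.contForm f g)) := by
  rw [contForm_eq hf hg]
  exact E.tendsto_approxForm ⟨_, hf⟩ ⟨_, hg⟩

theorem contForm_sum_left {ι : Type*} (s : Finset ι) {f : ι → C(M, ℝ)} {g : C(M, ℝ)}
    (hf : ∀ i, f i ∈ E.contDomain) (hg : g ∈ E.contDomain)
    (hs : ∑ i ∈ s, f i ∈ E.contDomain) :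
    E.contForm (∑ i ∈ s, f i) g = ∑ i ∈ s, E.contForm (f i) g := by
  have h1 := tendsto_finsetSum s fun i _ => tendsto_kernelForm_tmul (hf i) hg
  refine tendsto_nhds_unique (tendsto_kernelForm_tmul hs hg) (h1.congr fun n => ?_)
  rw [TensorProduct.sum_tmul, map_sum]

/-- If f is within 1/2 of the constant 1, then 2f ≥ 1, so truncating 2f at 1 gives exactly 1. -/
theorem one_mem_contDomain (hreg : E.IsRegular) : (1 : C(M, ℝ)) ∈ E.contDomain := by
  obtain ⟨f, hf, hd⟩ := hreg.1.exists_dist_lt 1 (by norm_num : (0 : ℝ) < 1 / 2)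
  have hf2 : ∀ x, 1 ≤ 2 * f x := fun x => by
    have h1 := (ContinuousMap.dist_apply_le_dist x).trans_lt hd
    rw [Real.dist_eq, abs_lt, ContinuousMap.one_apply] at h1
    linarith
  let v : E.domain := (2 : ℝ) • ⟨_, hf⟩
  have hv : (v : Lp ℝ 2 μ) = ContinuousMap.toLp 2 μ ℝ ((2 : ℝ) • f) := by
    rw [map_smul]; rfl
  obtain ⟨h, -⟩ := E.markov_inf v (by
    rw [hv]
    refine toLp_nonneg fun x => ?_
    change 0 ≤ 2 * f x
    linarith [hf2 x])
  have heq : (v : Lp ℝ 2 μ) ⊓ Lp.const 2 μ (1 : ℝ) = ContinuousMap.toLp 2 μ ℝ (1 : C(M, ℝ)) := by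
    rw [hv]
    apply Lp.ext
    filter_upwards [Lp.coeFn_inf (ContinuousMap.toLp 2 μ ℝ ((2 : ℝ) • f)) (Lp.const 2 μ (1 : ℝ)),
      ContinuousMap.coeFn_toLp (p := 2) μ (𝕜 := ℝ) ((2 : ℝ) • f),
      ContinuousMap.coeFn_toLp (p := 2) μ (𝕜 := ℝ) (1 : C(M, ℝ)),
      Lp.coeFn_const (p := 2) (μ := μ) (1 : ℝ)] with x h1 h2 h3 h4
    rw [h1, Pi.inf_apply, h2, h3, h4]
    simpa using hf2 x
  rwa [heq] at h

theorem form_one (hloc : E.IsStronglyLocal) (h : (1 : C(M, ℝ)) ∈ E.contDomain) (w : E.domain) :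
    E.form ⟨_, h⟩ w = 0 := by
  refine hloc _ _ ⟨Set.univ, isOpen_univ, Set.subset_univ _, 1, ?_⟩
  filter_upwards [ContinuousMap.coeFn_toLp (p := 2) μ (𝕜 := ℝ) (1 : C(M, ℝ))] with x hx _
  simpa using hx

/-- By strong locality the constant 1 solves its own resolvent equation, so kernels depending on one
variable contribute nothing. -/
theorem approxForm_one_right (hreg : E.IsRegular) (hloc : E.IsStronglyLocal) (n : ℕ)
    (f : Lp ℝ 2 μ) : E.approxForm n f (ContinuousMap.toLp 2 μ ℝ (1 : C(M, ℝ))) = 0 := by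
  have h1 : E.approx n (ContinuousMap.toLp 2 μ ℝ (1 : C(M, ℝ))) =
      ⟨_, one_mem_contDomain hreg⟩ :=
    E.approx_unique n fun w => by simp [form_one hloc]
  rw [approxForm_comm, approxForm, h1]
  simp

/-- This is -2 times the approximate analogue of `energy`. -/
theorem kernelForm_diffKernel_sq (hreg : E.IsRegular) (hloc : E.IsStronglyLocal) (n : ℕ)
    (φ f : C(M, ℝ)) : E.kernelForm n ((φ ⊗ₜ 1) * diffKernel f ^ 2) =
      -2 * E.kernelForm n ((φ * f) ⊗ₜ f) + E.kernelForm n (φ ⊗ₜ (f * f)) := by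
  rw [diffKernel_sq, mul_add, mul_sub, mul_smul_comm]
  simp only [Algebra.TensorProduct.tmul_mul_tmul, mul_one, one_mul, map_add, map_sub, map_smul,
    smul_eq_mul]
  rw [kernelForm_tmul (f := φ * (f * f)), approxForm_one_right hreg hloc]
  ring

theorem kernelForm_one_mul_diffKernel_sq (hreg : E.IsRegular) (hloc : E.IsStronglyLocal) (n : ℕ)
    (f : C(M, ℝ)) : E.kernelForm n (diffKernel f ^ 2) = -2 * E.kernelForm n (f ⊗ₜ f) := by
  have h := kernelForm_diffKernel_sq hreg hloc n 1 f
  rw [← Algebra.TensorProduct.one_def, one_mul, one_mul] at h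
  rw [h, kernelForm_tmul (f := 1), approxForm_comm, approxForm_one_right hreg hloc, add_zero]

/-- The functional `φ ↦ ∫ φ dγ(u, u)` defined by the energy measure. -/
def energy (E : DirichletForm μ) (u φ : C(M, ℝ)) : ℝ :=
  E.contForm (φ * u) u - 1 / 2 * E.contForm φ (u * u)

/-- `u` lies in the domain and `dγ(u, u) ≤ C dμ`. -/
def EnergyBounded (E : DirichletForm μ) (u : C(M, ℝ)) (C : ℝ) : Prop :=
  u ∈ E.contDomain ∧
    ∀ φ ∈ E.contDomain, 0 ≤ φ → E.energy u φ ≤ C * ∫ x, φ x ∂μ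

theorem EnergyLe.energyBounded {u : C(M, ℝ)} (hu : E.EnergyLe u) : E.EnergyBounded u 1 := by
  obtain ⟨f, hf, hf1, -, -, huD, h⟩ := hu
  refine ⟨huD, fun φ hφ hφ0 => ?_⟩
  obtain ⟨h1, h2, h3⟩ := h φ hφ
  rw [energy, contForm_eq h1 huD, contForm_eq hφ h2, h3, one_mul]
  refine integral_mono_measure ?_ (ae_of_all _ hφ0) φ.integrable_of_compactSpace
  calc μ.withDensity f ≤ μ.withDensity 1 := withDensity_mono (ae_of_all _ hf1)
    _ = μ := withDensity_one

variable [T2Space M]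

/-- The difference of the two sides of `hg` is a nonnegative kernel vanishing on the diagonal. Hence
the approximating energies of g are bounded by ∑ cᵢ ℰ(uᵢ), uniformly in n. -/
theorem mem_contDomain_of_contraction (hreg : E.IsRegular) (hloc : E.IsStronglyLocal)
    {ι : Type*} [Fintype ι] {u : ι → C(M, ℝ)} {c : ι → ℝ} {g : C(M, ℝ)}
    (hu : ∀ i, u i ∈ E.contDomain) (hc : ∀ i, 0 ≤ c i)
    (hg : ∀ x y, (g x - g y) ^ 2 ≤ ∑ i, c i * (u i x - u i y) ^ 2) : g ∈ E.contDomain := by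
  obtain ⟨v, hv, -⟩ := E.exists_domain_of_bounded (ContinuousMap.toLp 2 μ ℝ g)
    (C := ∑ i, c i * E.form ⟨_, hu i⟩ ⟨_, hu i⟩) (fun n => by
      have h := E.kernelForm_nonpos n (∑ i, c i • diffKernel (u i) ^ 2 - diffKernel g ^ 2)
        (fun x y => by simpa using hg x y) (fun x => by simp)
      simp only [map_sub, map_sum, map_smul, kernelForm_one_mul_diffKernel_sq hreg hloc,
        smul_eq_mul] at h
      have h1 : ∑ i, c i * E.kernelForm n (u i ⊗ₜ u i) ≤
          ∑ i, c i * E.form ⟨_, hu i⟩ ⟨_, hu i⟩ :=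
        Finset.sum_le_sum fun i _ => mul_le_mul_of_nonneg_left
          (E.approxForm_self_le n ⟨_, hu i⟩) (hc i)
      have h2 : ∑ i, c i * (-2 * E.kernelForm n (u i ⊗ₜ u i)) =
          -2 * ∑ i, c i * E.kernelForm n (u i ⊗ₜ u i) := by
        rw [Finset.mul_sum]
        exact Finset.sum_congr rfl fun i _ => by ring
      rw [h2] at h
      change E.kernelForm n (g ⊗ₜ g) ≤ _
      linarith)
  exact (hv ▸ v.2 : ContinuousMap.toLp 2 μ ℝ g ∈ E.domain)

theorem mul_mem_contDomain (hreg : E.IsRegular) (hloc : E.IsStronglyLocal) {f g : C(M, ℝ)}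
    (hf : f ∈ E.contDomain) (hg : g ∈ E.contDomain) : f * g ∈ E.contDomain := by
  refine mem_contDomain_of_contraction hreg hloc (u := ![f, g])
    (c := ![2 * ‖g‖ ^ 2, 2 * ‖f‖ ^ 2]) ?_ ?_ fun x y => ?_
  · intro i; fin_cases i <;> assumption
  · intro i; fin_cases i <;> simp
  · simp only [Fin.sum_univ_two, Matrix.cons_val_zero, Matrix.cons_val_one,
      ContinuousMap.mul_apply]
    have h1 : g x ^ 2 ≤ ‖g‖ ^ 2 := sq_le_sq' (neg_le_of_abs_le (g.norm_coe_le_norm x))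
      (le_of_abs_le (g.norm_coe_le_norm x))
    have h2 : f y ^ 2 ≤ ‖f‖ ^ 2 := sq_le_sq' (neg_le_of_abs_le (f.norm_coe_le_norm y))
      (le_of_abs_le (f.norm_coe_le_norm y))
    calc (f x * g x - f y * g y) ^ 2 = (g x * (f x - f y) + f y * (g x - g y)) ^ 2 := by ring
      _ ≤ 2 * (g x ^ 2 * (f x - f y) ^ 2) + 2 * (f y ^ 2 * (g x - g y) ^ 2) := by
          nlinarith [sq_nonneg (g x * (f x - f y) - f y * (g x - g y))]
      _ ≤ 2 * (‖g‖ ^ 2 * (f x - f y) ^ 2) + 2 * (‖f‖ ^ 2 * (g x - g y) ^ 2) := by gcongr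
      _ = _ := by ring

theorem tendsto_kernelForm_energy (hreg : E.IsRegular) (hloc : E.IsStronglyLocal)
    {u φ : C(M, ℝ)} (hu : u ∈ E.contDomain) (hφ : φ ∈ E.contDomain) :
    Tendsto (fun n => E.kernelForm n ((φ ⊗ₜ 1) * diffKernel u ^ 2)) atTop
      (𝓝 (-2 * E.energy u φ)) := by
  have h1 := ((tendsto_kernelForm_tmul (mul_mem_contDomain hreg hloc hφ hu) hu).const_mul
    (-2)).add (tendsto_kernelForm_tmul hφ (mul_mem_contDomain hreg hloc hu hu))
  simp only [kernelForm_diffKernel_sq hreg hloc]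
  convert h1 using 2
  rw [energy]
  ring

/-- The same kernel, multiplied by φ(x) ≥ 0, is again admissible; the inequality then passes to the
limit in n. -/
theorem energy_le_of_contraction (hreg : E.IsRegular) (hloc : E.IsStronglyLocal)
    {ι : Type*} [Fintype ι] {u : ι → C(M, ℝ)} {c : ι → ℝ} {g φ : C(M, ℝ)}
    (hu : ∀ i, u i ∈ E.contDomain) (hc : ∀ i, 0 ≤ c i)
    (hg : ∀ x y, (g x - g y) ^ 2 ≤ ∑ i, c i * (u i x - u i y) ^ 2)
    (hφ : φ ∈ E.contDomain) (hφ0 : 0 ≤ φ) :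
    E.energy g φ ≤ ∑ i, c i * E.energy (u i) φ := by
  have hgD := mem_contDomain_of_contraction hreg hloc hu hc hg
  have h1 := (tendsto_finsetSum Finset.univ fun i _ =>
    (tendsto_kernelForm_energy hreg hloc (hu i) hφ).const_mul (c i)).sub
      (tendsto_kernelForm_energy hreg hloc hgD hφ)
  have h2 := le_of_tendsto' h1 (b := 0) fun n => by
    have h := E.kernelForm_nonpos n
      ((φ ⊗ₜ 1) * (∑ i, c i • diffKernel (u i) ^ 2 - diffKernel g ^ 2))
      (fun x y => by simpa using mul_nonneg (hφ0 x) (sub_nonneg.2 (hg x y))) (fun x => by simp)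
    simpa only [mul_sub, Finset.mul_sum, mul_smul_comm, map_sub, map_sum, map_smul,
      smul_eq_mul] using h
  have h3 : ∑ i, c i * (-2 * E.energy (u i) φ) = -2 * ∑ i, c i * E.energy (u i) φ := by
    rw [Finset.mul_sum]
    exact Finset.sum_congr rfl fun i _ => by ring
  rw [h3] at h2
  linarith

/-- The localisation inequality: the kernel `(η(x) - η(y))² (v(x) - v(y))²` is nonnegative. -/
theorem contForm_mul_self_le (hreg : E.IsRegular) (hloc : E.IsStronglyLocal)
    {η v : C(M, ℝ)} (hη : η ∈ E.contDomain) (hv : v ∈ E.contDomain) :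
    E.contForm (η * v) (η * v) ≤ E.contForm (η * η * v) v + E.energy η (v * v) := by
  have hηη := mul_mem_contDomain hreg hloc hη hη
  have hvv := mul_mem_contDomain hreg hloc hv hv
  have hηv := mul_mem_contDomain hreg hloc hη hv
  -- Of the nine terms of the expanded kernel, the two with a factor 1 vanish and the rest merge by
  -- symmetry into four, with coefficients -4, 2, 4, -4. The limit, divided by 4, is the claim.
  have h1 := (((tendsto_kernelForm_tmul (mul_mem_contDomain hreg hloc hηη hv) hv).const_mul
    (-4)).add ((tendsto_kernelForm_tmul hvv hηη).const_mul 2)).add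
      (((tendsto_kernelForm_tmul hηv hηv).const_mul 4).sub
      ((tendsto_kernelForm_tmul (mul_mem_contDomain hreg hloc hvv hη) hη).const_mul 4))
  have h2 := le_of_tendsto' h1 (b := 0) fun n => by
    have h := E.kernelForm_nonpos n (diffKernel η ^ 2 * diffKernel v ^ 2)
      (fun x y => by simp only [map_mul, map_pow]; positivity) (fun x => by simp)
    have hsymm : ∀ f g : C(M, ℝ), E.kernelForm n (f ⊗ₜ g) = E.kernelForm n (g ⊗ₜ f) :=
      fun f g => E.approxForm_comm n _ _
    have hone : ∀ f : C(M, ℝ), E.kernelForm n (f ⊗ₜ 1) = 0 :=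
      fun f => approxForm_one_right hreg hloc n _
    simp only [diffKernel_sq, add_mul, sub_mul, mul_add, mul_sub, mul_smul_comm, smul_mul_assoc,
      Algebra.TensorProduct.tmul_mul_tmul, mul_one, one_mul, map_add, map_sub, map_smul,
      smul_eq_mul, hsymm 1, hone] at h
    rw [hsymm (η * η) (v * v), hsymm v (η * η * v), hsymm η (η * (v * v)),
      mul_comm η (v * v)] at h
    linarith
  rw [energy]
  linarith

theorem EnergyBounded.of_contraction (hreg : E.IsRegular) (hloc : E.IsStronglyLocal)
    {ι : Type*} [Fintype ι] {u : ι → C(M, ℝ)} {c C : ι → ℝ} {g : C(M, ℝ)}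
    (hu : ∀ i, E.EnergyBounded (u i) (C i)) (hc : ∀ i, 0 ≤ c i)
    (hg : ∀ x y, (g x - g y) ^ 2 ≤ ∑ i, c i * (u i x - u i y) ^ 2) :
    E.EnergyBounded g (∑ i, c i * C i) := by
  refine ⟨mem_contDomain_of_contraction hreg hloc (fun i => (hu i).1) hc hg, fun φ hφ hφ0 => ?_⟩
  refine (energy_le_of_contraction hreg hloc (fun i => (hu i).1) hc hg hφ hφ0).trans ?_
  rw [Finset.sum_mul]
  refine Finset.sum_le_sum fun i _ => ?_
  rw [mul_assoc]
  exact mul_le_mul_of_nonneg_left ((hu i).2 φ hφ hφ0) (hc i)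

/-- Localisation of the form by a partition `∑ ηᵢ² = 1`. -/
theorem sum_contForm_mul_le (hreg : E.IsRegular) (hloc : E.IsStronglyLocal)
    {ι : Type*} [Fintype ι] {η : ι → C(M, ℝ)} {C : ι → ℝ}
    (hη : ∀ i, E.EnergyBounded (η i) (C i)) (hsum : ∑ i, η i * η i = 1) {v : C(M, ℝ)}
    (hv : v ∈ E.contDomain) :
    ∑ i, E.contForm (η i * v) (η i * v) ≤
      E.contForm v v + (∑ i, C i) * ∫ x, v x * v x ∂μ := by
  have hm := fun i => mul_mem_contDomain hreg hloc
    (mul_mem_contDomain hreg hloc (hη i).1 (hη i).1) hv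
  have hs : ∑ i, η i * η i * v = v := by rw [← Finset.sum_mul, hsum, one_mul]
  -- The main terms of the localisation inequality recombine exactly to ℰ(v); only the energy terms
  -- remain as an error.
  have h1 : ∑ i, E.contForm (η i * η i * v) v = E.contForm v v := by
    rw [← contForm_sum_left Finset.univ hm hv (by rwa [hs]), hs]
  rw [← h1, Finset.sum_mul, ← Finset.sum_add_distrib]
  refine Finset.sum_le_sum fun i _ => ?_
  refine (contForm_mul_self_le hreg hloc (hη i).1 hv).trans ?_
  gcongr
  exact (hη i).2 (v * v) (mul_mem_contDomain hreg hloc hv hv) fun x => mul_self_nonneg (v x)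

end EnergyFunctional

/-! ### Cutoff functions and partitions from the intrinsic distance -/

section Cutoff

variable {M : Type*} [TopologicalSpace M] [CompactSpace M] [MeasurableSpace M]
  [BorelSpace M] {μ : Measure M} [IsFiniteMeasure μ] {E : DirichletForm μ}

theorem exists_energyLe_of_notMem_ball {x y : M} {r : ℝ} (hr : 0 < r) (hy : y ∉ E.ball x r) :
    ∃ u : C(M, ℝ), E.EnergyLe u ∧ r / 2 < u x - u y := by
  have h1 : ENNReal.ofReal (r / 2) < E.dist x y :=
    ((ENNReal.ofReal_lt_ofReal_iff hr).2 (half_lt_self hr)).trans_le (not_lt.1 hy)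
  obtain ⟨u, hu⟩ := lt_iSup_iff.1 h1
  obtain ⟨hmem, hlt⟩ := lt_iSup_iff.1 hu
  exact ⟨u, hmem.2, ((ENNReal.ofReal_lt_ofReal_iff_of_nonneg (by positivity)).1 hlt)⟩

variable [T2Space M]

/-- The complement of the interior of the ball is compact, so finitely many competitors for d
already separate it from x. Truncating the sum of their positive parts gives ψ, without d itself
having to lie in the domain. The interior is used because the balls are only assumed to be
neighbourhoods. -/
theorem exists_cutoff (hreg : E.IsRegular) (hloc : E.IsStronglyLocal) (hcomp : E.DistCompatible)
    (x : M) {r : ℝ} (hr : 0 < r) :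
    ∃ (ψ : C(M, ℝ)) (C : ℝ), E.EnergyBounded ψ C ∧ 0 < ψ x ∧ tsupport ψ ⊆ E.ball x r := by
  obtain ⟨δ, hδ, hball⟩ := (hcomp x).mem_iff.1
    (interior_mem_nhds.2 ((hcomp x).mem_of_mem hr))
  have hex : ∀ y : ↥((interior (E.ball x r))ᶜ : Set M),
      ∃ u : C(M, ℝ), E.EnergyLe u ∧ δ / 2 < u x - u y :=
    fun y => exists_energyLe_of_notMem_ball hδ fun h => y.2 (hball h)
  choose u hu hlt using hex
  obtain ⟨t, ht⟩ := isOpen_interior.isClosed_compl.isCompact.elim_finite_subcover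
    (fun y => {z | δ / 2 < u y x - u y z})
    (fun y => isOpen_lt continuous_const (continuous_const.sub (u y).continuous))
    (fun z hz => Set.mem_iUnion.2 ⟨⟨z, hz⟩, hlt ⟨z, hz⟩⟩)
  let s : C(M, ℝ) := ⟨fun z => ∑ y : t, max (u y x - u y z) 0, by fun_prop⟩
  let ψ : C(M, ℝ) := ⟨fun z => max (δ / 2 - s z) 0, by fun_prop⟩
  have hs : ∀ z, s z = ∑ y : t, max (u y x - u y z) 0 := fun _ => rfl
  have hψ : ∀ z, ψ z = max (δ / 2 - s z) 0 := fun _ => rfl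
  -- The weight `Fintype.card t` comes from Cauchy–Schwarz, applied to |ψ(a) - ψ(b)| ≤ ∑ |u_y(a) -
  -- u_y(b)|.
  refine ⟨ψ, ∑ y : t, (Fintype.card t : ℝ) * 1, EnergyBounded.of_contraction hreg hloc
    (u := fun y : t => u y) (fun y => (hu y).energyBounded) (fun _ => Nat.cast_nonneg _)
    (fun a b => ?_), ?_, ?_⟩
  · have h1 : |ψ a - ψ b| ≤ ∑ y : t, |u y a - u y b| := by
      calc |ψ a - ψ b| ≤ |(δ / 2 - s a) - (δ / 2 - s b)| := abs_max_sub_max_le_abs _ _ _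
        _ = |∑ y : t, (max (u y x - u y b) 0 - max (u y x - u y a) 0)| := by
            rw [Finset.sum_sub_distrib, ← hs, ← hs]; congr 1; ring
        _ ≤ ∑ y : t, |max (u y x - u y b) 0 - max (u y x - u y a) 0| :=
            Finset.abs_sum_le_sum_abs _ _
        _ ≤ ∑ y : t, |u y a - u y b| := Finset.sum_le_sum fun y _ => by
            refine (abs_max_sub_max_le_abs _ _ _).trans (le_of_eq ?_)
            congr 1; ring
    calc (ψ a - ψ b) ^ 2 = |ψ a - ψ b| ^ 2 := (sq_abs _).symm
      _ ≤ (∑ y : t, |u y a - u y b|) ^ 2 := by gcongr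
      _ ≤ (Fintype.card t : ℝ) * ∑ y : t, |u y a - u y b| ^ 2 := sq_sum_le_card_mul_sum_sq
      _ = _ := by simp only [sq_abs, Finset.mul_sum]
  · rw [hψ, hs]
    simpa using hδ
  · have hsub : tsupport ψ ⊆ {z | s z ≤ δ / 2} := by
      refine closure_minimal (fun z hz => ?_) (isClosed_le s.continuous continuous_const)
      by_contra h
      refine hz ?_
      rw [hψ, max_eq_right]
      rw [Set.mem_ofPred_eq, not_le] at h
      linarith
    intro z hz
    by_contra hzb
    obtain ⟨y, hy, hyz⟩ := Set.mem_iUnion₂.1 (ht (fun h => hzb (interior_subset h)))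
    have h1 : max (u y x - u y z) 0 ≤ s z := by
      rw [hs]
      exact Finset.single_le_sum (f := fun y : t => max (u y x - u y z) 0)
        (fun _ _ => le_max_right _ _) (Finset.mem_univ (⟨y, hy⟩ : t))
    have h2 : s z ≤ δ / 2 := hsub hz
    have h3 : δ / 2 < u y x - u y z := hyz
    linarith [le_max_left (u y x - u y z) 0]

/-- The vector w of finitely many cutoffs has no zero, so its norm is bounded below by some δ > 0;
the ηᵢ are the components of w/‖w‖. -/
theorem exists_partition (hreg : E.IsRegular) (hloc : E.IsStronglyLocal)
    (hcomp : E.DistCompatible) {r : M → ℝ} (hr : ∀ x, 0 < r x) :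
    ∃ (t : Finset M) (η : t → C(M, ℝ)) (C : t → ℝ), (∀ i, E.EnergyBounded (η i) (C i)) ∧
      ∑ i, η i * η i = 1 ∧ ∀ i, tsupport (η i) ⊆ E.ball i (r i) := by
  choose ψ C hψ hpos hsupp using fun x => exists_cutoff hreg hloc hcomp x (hr x)
  obtain ⟨t, ht⟩ := isCompact_univ.elim_finite_subcover (fun x => {z | 0 < ψ x z})
    (fun x => isOpen_lt continuous_const (ψ x).continuous)
    (fun x _ => Set.mem_iUnion.2 ⟨x, hpos x⟩)
  let w : M → EuclideanSpace ℝ t := fun z => WithLp.toLp 2 fun i : t => ψ i z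
  have hw : Continuous w := by fun_prop
  have hwsq : ∀ z, ‖w z‖ ^ 2 = ∑ i : t, ψ i z ^ 2 := fun z => by
    rw [EuclideanSpace.norm_sq_eq]; simp [w]
  have hw0 : ∀ z, 0 < ‖w z‖ := by
    intro z
    obtain ⟨x, hx, hxz⟩ := Set.mem_iUnion₂.1 (ht (Set.mem_univ z))
    refine norm_pos_iff.2 fun h => ?_
    have h1 : w z ⟨x, hx⟩ = 0 := by rw [h]; rfl
    exact (show 0 < ψ x z from hxz).ne' h1
  obtain ⟨δ, hδ, hδw⟩ : ∃ δ > 0, ∀ z, δ ≤ ‖w z‖ := by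
    rcases isEmpty_or_nonempty M with hM | hM
    · exact ⟨1, one_pos, fun z => isEmptyElim z⟩
    · obtain ⟨z, -, hz⟩ := isCompact_univ.exists_isMinOn Set.univ_nonempty hw.norm.continuousOn
      exact ⟨‖w z‖, hw0 z, fun y => hz (Set.mem_univ y)⟩
  let η : t → C(M, ℝ) := fun i =>
    ⟨fun z => ψ i z / ‖w z‖, (ψ i).continuous.div hw.norm fun z => (hw0 z).ne'⟩
  have hη : ∀ i z, η i z = ψ i z / ‖w z‖ := fun _ _ => rfl
  -- The factor 4/δ² is the square of the Lipschitz bound 2/δ for w ↦ w/‖w‖ on ‖w‖ ≥ δ.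
  refine ⟨t, η, fun _ => ∑ j : t, 4 / δ ^ 2 * C j, fun i =>
    EnergyBounded.of_contraction hreg hloc (u := fun j : t => ψ j) (fun j => hψ j)
      (fun _ => by positivity) fun a b => ?_, ?_, fun i => ?_⟩
  · have h1 : ‖w a - w b‖ ^ 2 = ∑ j : t, (ψ j a - ψ j b) ^ 2 := by
      rw [EuclideanSpace.norm_sq_eq]; simp [w]
    have h2 : |ψ i a - ψ i b| ≤ ‖w a - w b‖ := PiLp.norm_apply_le (w a - w b) i
    have h3 : |ψ i b| ≤ ‖w b‖ := PiLp.norm_apply_le (w b) i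
    have h4 : |‖w b‖ - ‖w a‖| ≤ ‖w a - w b‖ := by
      rw [norm_sub_rev (w a)]; exact abs_norm_sub_norm_le _ _
    have ha := hw0 a
    have hb := hw0 b
    have h5 : |η i a - η i b| ≤ 2 / δ * ‖w a - w b‖ := by
      have e : η i a - η i b =
          ((ψ i a - ψ i b) + ψ i b / ‖w b‖ * (‖w b‖ - ‖w a‖)) / ‖w a‖ := by
        rw [hη, hη]; field_simp; ring
      rw [e, abs_div, abs_of_pos ha]
      have h6 : |ψ i b / ‖w b‖| ≤ 1 := by
        rw [abs_div, abs_of_pos hb]; exact div_le_one_of_le₀ h3 hb.le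
      have h7 : |(ψ i a - ψ i b) + ψ i b / ‖w b‖ * (‖w b‖ - ‖w a‖)| ≤ 2 * ‖w a - w b‖ := by
        refine (abs_add_le _ _).trans ?_
        rw [abs_mul]
        have := mul_le_mul h6 h4 (abs_nonneg _) zero_le_one
        linarith
      calc _ ≤ 2 * ‖w a - w b‖ / δ := div_le_div₀ (by positivity) h7 hδ (hδw a)
        _ = _ := by ring
    rw [← Finset.mul_sum, ← h1, ← sq_abs]
    calc |η i a - η i b| ^ 2 ≤ (2 / δ * ‖w a - w b‖) ^ 2 := by gcongr
      _ = _ := by ring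
  · ext z
    have h1 : ∑ i : t, η i z * η i z = (∑ i : t, ψ i z ^ 2) / ‖w z‖ ^ 2 := by
      rw [Finset.sum_div]
      exact Finset.sum_congr rfl fun i _ => by rw [hη]; ring
    rw [ContinuousMap.sum_apply]
    simp only [ContinuousMap.mul_apply, ContinuousMap.one_apply]
    rw [h1, ← hwsq, div_self (pow_pos (hw0 z) 2).ne']
  · refine (closure_mono fun z hz => ?_).trans (hsupp i)
    intro h
    exact hz (by rw [hη, h, zero_div])

end Cutoff

/-! ### From local to global Sobolev inequalities -/

section LocalToGlobal

theorem two_lt_sobolevExponent {ν : ℝ} (hν : 2 < ν) : 2 < sobolevExponent ν := by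
  rw [sobolevExponent, show (2 : ℝ≥0∞) = ENNReal.ofReal 2 by simp]
  refine (ENNReal.ofReal_lt_ofReal_iff_of_nonneg (by norm_num)).2 ?_
  rw [lt_div_iff₀ (by linarith)]
  linarith

/-- Turns the squared L^q norm into a norm of the square, to which Minkowski applies when q ≥ 2. -/
theorem eLpNorm_mul_self {M : Type*} [MeasurableSpace M] (μ : Measure M) (f : M → ℝ) (q : ℝ≥0∞) :
    eLpNorm (fun x => f x * f x) (q / 2) μ = eLpNorm f q μ ^ 2 := by
  have h := eLpNorm_norm_rpow (p := q / 2) (μ := μ) f (q := 2) (by norm_num)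
  rw [ENNReal.ofReal_ofNat, ENNReal.div_mul_cancel (by norm_num) (by norm_num)] at h
  rw [← ENNReal.rpow_natCast, Nat.cast_ofNat, ← h]
  congr 1
  ext x
  rw [Real.rpow_two, Real.norm_eq_abs, sq_abs, sq]

variable {M : Type*} [TopologicalSpace M] [MeasurableSpace M] {μ : Measure M} [IsFiniteMeasure μ]
  {E : DirichletForm μ}

theorem SobolevOn.mono {ν A A' B B' : ℝ} {U U' : Set M} (h : E.SobolevOn ν U A B)
    (hA : A ≤ A') (hB : B ≤ B') (hU : U' ⊆ U) : E.SobolevOn ν U' A' B' := by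
  intro v hv
  refine (h v (hv.trans hU)).trans (ENNReal.ofReal_le_ofReal ?_)
  have := E.nonneg v
  gcongr

theorem exists_sobolevOn_of_optSobolev_lt {ν : ℝ} {U : Set M} {A : ℝ}
    (h : E.optSobolev ν U < ENNReal.ofReal A) : 0 < A ∧ ∃ B > 0, E.SobolevOn ν U A B := by
  obtain ⟨A', hA'⟩ := iInf_lt_iff.1 h
  obtain ⟨⟨hpos, B, hB, hS⟩, hlt⟩ := iInf_lt_iff.1 hA'
  have hAA : A' < A := (ENNReal.ofReal_lt_ofReal_iff_of_nonneg hpos.le).1 hlt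
  exact ⟨hpos.trans hAA, B, hB, hS.mono hAA.le le_rfl subset_rfl⟩

theorem optSobolev_le {ν : ℝ} {U : Set M} {A B : ℝ} (hA : 0 < A) (hB : 0 < B)
    (h : E.SobolevOn ν U A B) : E.optSobolev ν U ≤ ENNReal.ofReal A :=
  iInf₂_le A ⟨hA, B, hB, h⟩

theorem optSobolev_mono {ν : ℝ} {U U' : Set M} (h : U ⊆ U') :
    E.optSobolev ν U ≤ E.optSobolev ν U' :=
  le_iInf₂ fun _ ⟨hA, _, hB, hS⟩ => optSobolev_le hA hB (hS.mono le_rfl le_rfl h)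

variable [CompactSpace M] [BorelSpace M]

theorem ball_mono (x : M) {r s : ℝ} (h : r ≤ s) : E.ball x r ⊆ E.ball x s :=
  fun _ hy => lt_of_lt_of_le hy (ENNReal.ofReal_le_ofReal h)

theorem eLpNorm_toLp (f : C(M, ℝ)) (q : ℝ≥0∞) :
    eLpNorm (ContinuousMap.toLp 2 μ ℝ f) q μ = eLpNorm f q μ :=
  eLpNorm_congr_ae (ContinuousMap.coeFn_toLp μ f)

theorem norm_toLp_sq (f : C(M, ℝ)) :
    ‖ContinuousMap.toLp 2 μ ℝ f‖ ^ 2 = ∫ x, f x * f x ∂μ := by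
  rw [← real_inner_self_eq_norm_sq, inner_toLp_eq_integral]

theorem essSupport_toLp_subset (f : C(M, ℝ)) :
    essSupport μ (ContinuousMap.toLp 2 μ ℝ f) ⊆ tsupport f := by
  intro x hx
  by_contra h
  refine hx (tsupport f)ᶜ ((isClosed_tsupport f).isOpen_compl.mem_nhds h) ?_
  filter_upwards [ContinuousMap.coeFn_toLp (p := 2) μ (𝕜 := ℝ) f] with y hy hyt
  rw [hy]
  exact image_eq_zero_of_notMem_tsupport hyt

theorem SobolevOn.contForm {ν A B : ℝ} {U : Set M} (h : E.SobolevOn ν U A B) {f : C(M, ℝ)}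
    (hf : f ∈ E.contDomain) (hU : tsupport f ⊆ U) :
    eLpNorm f (sobolevExponent ν) μ ^ 2 ≤
      ENNReal.ofReal (A * E.contForm f f + B * ∫ x, f x * f x ∂μ) := by
  have h1 := h ⟨_, hf⟩ ((essSupport_toLp_subset f).trans hU)
  rwa [eLpNorm_toLp, norm_toLp_sq, ← contForm_eq hf hf] at h1

/-- A Sobolev inequality for the continuous functions of the domain extends to the domain. -/
theorem sobolevOn_univ_of_contDomain (hreg : E.IsRegular) {ν A B : ℝ}
    (h : ∀ f ∈ E.contDomain, eLpNorm f (sobolevExponent ν) μ ^ 2 ≤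
      ENNReal.ofReal (A * E.contForm f f + B * ∫ x, f x * f x ∂μ)) :
    E.SobolevOn ν Set.univ A B := by
  intro v _
  choose w hw hlt using fun n : ℕ => hreg.2 v (1 / ((n : ℝ) + 1)) Nat.one_div_pos_of_nat
  have hlim : Tendsto (fun n => E.form (v - w n) (v - w n)
      + ‖((v - w n : E.domain) : Lp ℝ 2 μ)‖ ^ 2) atTop (𝓝 0) :=
    squeeze_zero (fun n => add_nonneg (E.nonneg _) (sq_nonneg _)) (fun n => (hlt n).le)
      tendsto_one_div_add_atTop_nhds_zero_nat
  have h1 : Tendsto (fun n => E.form (w n - v) (w n - v)) atTop (𝓝 0) := by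
    refine squeeze_zero (fun n => E.nonneg _) (fun n => ?_) hlim
    rw [← neg_sub v, map_neg, map_neg, LinearMap.neg_apply, neg_neg]
    exact le_add_of_nonneg_right (sq_nonneg _)
  have h2 : Tendsto (fun n => (w n : Lp ℝ 2 μ)) atTop (𝓝 v) := by
    have h3 : Tendsto (fun n => ‖((v - w n : E.domain) : Lp ℝ 2 μ)‖ ^ 2) atTop (𝓝 0) :=
      squeeze_zero (fun n => sq_nonneg _) (fun n => le_add_of_nonneg_left (E.nonneg _)) hlim
    have h4 := h3.sqrt
    simp only [Real.sqrt_sq (norm_nonneg _), Real.sqrt_zero, Submodule.coe_sub] at h4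
    refine tendsto_iff_norm_sub_tendsto_zero.2 ?_
    simpa only [norm_sub_rev] using h4
  -- Almost everywhere convergence along a subsequence and Fatou suffice; finiteness of the L^q norm
  -- of v is a consequence.
  obtain ⟨ns, hns, hae⟩ := (tendstoInMeasure_of_tendsto_Lp h2).exists_seq_tendsto_ae
  have hbound : ∀ n, eLpNorm (w n : Lp ℝ 2 μ) (sobolevExponent ν) μ ≤
      ENNReal.ofReal (A * E.form (w n) (w n) + B * ‖(w n : Lp ℝ 2 μ)‖ ^ 2) ^ (1 / 2 : ℝ) := by
    intro n
    obtain ⟨f, hf, hfw⟩ := hw n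
    have h5 := h f hf
    rw [← norm_toLp_sq, contForm_eq hf hf, ← eLpNorm_toLp] at h5
    have h6 : (⟨_, hf⟩ : E.domain) = w n := Subtype.ext hfw
    rw [h6, hfw] at h5
    rw [one_div, ENNReal.le_rpow_inv_iff (by norm_num)]
    simpa using h5
  have hb : Tendsto (fun n =>
      ENNReal.ofReal (A * E.form (w n) (w n) + B * ‖(w n : Lp ℝ 2 μ)‖ ^ 2) ^ (1 / 2 : ℝ)) atTop
      (𝓝 (ENNReal.ofReal (A * E.form v v + B * ‖(v : Lp ℝ 2 μ)‖ ^ 2) ^ (1 / 2 : ℝ))) :=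
    (ENNReal.continuous_rpow_const.tendsto _).comp (ENNReal.tendsto_ofReal
      (((E.tendsto_form_self h1).const_mul A).add ((h2.norm.pow 2).const_mul B)))
  have h7 : eLpNorm (v : Lp ℝ 2 μ) (sobolevExponent ν) μ ≤
      ENNReal.ofReal (A * E.form v v + B * ‖(v : Lp ℝ 2 μ)‖ ^ 2) ^ (1 / 2 : ℝ) := by
    refine (Lp.eLpNorm_lim_le_liminf_eLpNorm
      (fun n => (Lp.aestronglyMeasurable (w (ns n) : Lp ℝ 2 μ))) _ hae).trans ?_
    rw [← (hb.comp hns.tendsto_atTop).liminf_eq]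
    exact liminf_le_liminf (Eventually.of_forall fun n => hbound (ns n))
  rw [one_div, ENNReal.le_rpow_inv_iff (by norm_num)] at h7
  simpa using h7

/-- Minkowski in L^{q/2} splits the left side over the pieces ηᵢ v, the local inequalities apply to
each, and localisation reassembles ℰ(v) with coefficient 1. Hence A is preserved. -/
theorem exists_sobolevOn_univ [T2Space M] (hreg : E.IsRegular) (hloc : E.IsStronglyLocal)
    (hcomp : E.DistCompatible) {ν : ℝ} (hν : 2 < ν) {A : ℝ} (hA : 0 < A)
    (h : ∀ x, ∃ r > 0, ∃ B > 0, E.SobolevOn ν (E.ball x r) A B) :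
    ∃ B > 0, E.SobolevOn ν Set.univ A B := by
  choose r hr B hB hS using h
  obtain ⟨t, η, C, hη, hsum, hsupp⟩ := exists_partition hreg hloc hcomp hr
  have hsum' : ∀ x, ∑ i, η i x * η i x = 1 := fun x => by
    have := congrArg (fun f : C(M, ℝ) => f x) hsum
    simpa [ContinuousMap.sum_apply] using this
  -- The sum collects the localisation error and the local constants; the maximum with 1 ensures
  -- positivity, as the `C i` carry no sign.
  refine ⟨max (A * ∑ i, C i + ∑ i : t, B i) 1, lt_max_of_lt_right one_pos,
    sobolevOn_univ_of_contDomain hreg fun v hv => ?_⟩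
  have hm := fun i => mul_mem_contDomain hreg hloc (hη i).1 hv
  have hsq : (fun x => v x * v x) = ∑ i, fun x => (η i * v) x * (η i * v) x := by
    ext x
    rw [Finset.sum_apply]
    simp only [ContinuousMap.mul_apply]
    rw [← one_mul (v x * v x), ← hsum' x, Finset.sum_mul]
    exact Finset.sum_congr rfl fun i _ => by ring
  have hq : 1 ≤ sobolevExponent ν / 2 := by
    rw [ENNReal.le_div_iff_mul_le (by simp) (by simp), one_mul]
    exact (two_lt_sobolevExponent hν).le
  have hint : 0 ≤ ∫ x, v x * v x ∂μ := integral_nonneg fun x => mul_self_nonneg _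
  have hterm : ∀ i, ∫ x, (η i * v) x * (η i * v) x ∂μ ≤ ∫ x, v x * v x ∂μ := fun i => by
    refine integral_mono (η i * v * (η i * v)).integrable_of_compactSpace
      (v * v).integrable_of_compactSpace fun x => ?_
    have h1 : η i x * η i x ≤ 1 := by
      rw [← hsum' x]
      exact Finset.single_le_sum (f := fun i => η i x * η i x)
        (fun _ _ => mul_self_nonneg _) (Finset.mem_univ i)
    have h2 := mul_le_mul_of_nonneg_right h1 (mul_self_nonneg (v x))
    simp only [ContinuousMap.mul_apply]
    linarith
  calc eLpNorm v (sobolevExponent ν) μ ^ 2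
      = eLpNorm (∑ i, fun x => (η i * v) x * (η i * v) x) (sobolevExponent ν / 2) μ := by
        rw [← eLpNorm_mul_self, hsq]
    _ ≤ ∑ i, eLpNorm (fun x => (η i * v) x * (η i * v) x) (sobolevExponent ν / 2) μ :=
        eLpNorm_sum_le
          (fun i _ => ((η i * v) * (η i * v)).continuous.aestronglyMeasurable) hq
    _ ≤ ∑ i, ENNReal.ofReal (A * E.contForm (η i * v) (η i * v)
          + B i * ∫ x, (η i * v) x * (η i * v) x ∂μ) := Finset.sum_le_sum fun i _ => by
        rw [eLpNorm_mul_self]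
        exact (hS i).contForm (hm i) ((tsupport_mul_subset_left).trans (hsupp i))
    _ = ENNReal.ofReal (∑ i, (A * E.contForm (η i * v) (η i * v)
          + B i * ∫ x, (η i * v) x * (η i * v) x ∂μ)) := by
        rw [ENNReal.ofReal_sum_of_nonneg]
        exact fun i _ => add_nonneg (mul_nonneg hA.le (contForm_self_nonneg _))
          (mul_nonneg (hB i).le (integral_nonneg fun x => mul_self_nonneg _))
    _ ≤ _ := by
        refine ENNReal.ofReal_le_ofReal ?_
        rw [Finset.sum_add_distrib, ← Finset.mul_sum]
        have h1 := mul_le_mul_of_nonneg_left (sum_contForm_mul_le hreg hloc hη hsum hv) hA.le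
        have h2 : ∑ i : t, B i * ∫ x, (η i * v) x * (η i * v) x ∂μ ≤
            (∑ i : t, B i) * ∫ x, v x * v x ∂μ := by
          rw [Finset.sum_mul]
          exact Finset.sum_le_sum fun i _ => mul_le_mul_of_nonneg_left (hterm i) (hB i).le
        have h3 := mul_le_mul_of_nonneg_right (le_max_left (A * ∑ i, C i + ∑ i : t, B i) 1) hint
        linarith

theorem optSobolev_univ_eq [T2Space M] (hreg : E.IsRegular) (hloc : E.IsStronglyLocal)
    (hcomp : E.DistCompatible) {ν : ℝ} (hν : 2 < ν) :
    E.optSobolev ν Set.univ = ⨆ x, ⨅ r ∈ Set.Ioi (0 : ℝ), E.optSobolev ν (E.ball x r) := by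
  refine le_antisymm (le_of_forall_gt fun c hc => ?_) (iSup_le fun x =>
    (iInf₂_le 1 (Set.mem_Ioi.2 one_pos)).trans (optSobolev_mono (Set.subset_univ _)))
  obtain ⟨c', h1, h2⟩ := exists_between hc
  have hc' : ENNReal.ofReal c'.toReal = c' := ENNReal.ofReal_toReal h2.ne_top
  have hpos : 0 < c'.toReal := ENNReal.toReal_pos (bot_le.trans_lt h1).ne' h2.ne_top
  obtain ⟨B, hB, hS⟩ := exists_sobolevOn_univ hreg hloc hcomp hν hpos fun x => by
    have h3 := (le_iSup (fun x => ⨅ r ∈ Set.Ioi (0 : ℝ), E.optSobolev ν (E.ball x r)) x).trans_lt h1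
    obtain ⟨r, hr⟩ := iInf_lt_iff.1 h3
    obtain ⟨hr0, hlt⟩ := iInf_lt_iff.1 hr
    rw [← hc'] at hlt
    exact ⟨r, hr0, (exists_sobolevOn_of_optSobolev_lt hlt).2⟩
  exact (optSobolev_le hpos hB hS).trans_lt (by rwa [hc'])

end LocalToGlobal

end DirichletForm

theorem EReal.coe_ennreal_iInf {ι : Sort*} (f : ι → ℝ≥0∞) :
    ((⨅ i, f i : ℝ≥0∞) : EReal) = ⨅ i, (f i : EReal) := by
  refine le_antisymm (le_iInf fun i => EReal.coe_ennreal_le_coe_ennreal_iff.2 (iInf_le f i)) ?_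
  have h0 : (0 : EReal) ≤ ⨅ i, (f i : EReal) := le_iInf fun i => EReal.coe_ennreal_nonneg _
  rw [← EReal.coe_toENNReal h0]
  refine EReal.coe_ennreal_le_coe_ennreal_iff.2 (le_iInf fun i => ?_)
  rw [← EReal.coe_ennreal_le_coe_ennreal_iff, EReal.coe_toENNReal h0]
  exact iInf_le _ i

namespace DirichletForm

/-! ### Supports and the Hölder inequality -/

section EssSupport

variable {M : Type*} [TopologicalSpace M] [MeasurableSpace M] {μ : Measure M}

theorem isClosed_essSupport (f : M → ℝ) : IsClosed (essSupport μ f) := by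
  rw [← isOpen_compl_iff, isOpen_iff_mem_nhds]
  intro x hx
  obtain ⟨O, hO, hf⟩ : ∃ O ∈ 𝓝 x, ∀ᵐ y ∂μ, y ∈ O → f y = 0 := by
    simpa [essSupport] using hx
  filter_upwards [interior_mem_nhds.2 hO] with y hy hy'
  exact hy' O (mem_interior_iff_mem_nhds.1 hy) hf

/-- Without second countability the null neighbourhoods need not have a countable subcover; inner
regularity reduces to compact sets, where finitely many suffice. -/
theorem ae_eq_zero_of_notMem_essSupport [BorelSpace M] [IsFiniteMeasure μ] [μ.Regular]
    {f : M → ℝ} (hf : Measurable f) : ∀ᵐ x ∂μ, x ∉ essSupport μ f → f x = 0 := by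
  have hS : MeasurableSet ((essSupport μ f)ᶜ ∩ {x | f x ≠ 0}) :=
    (isClosed_essSupport f).isOpen_compl.measurableSet.inter
      (hf (measurableSet_singleton 0).compl)
  have h0 : μ ((essSupport μ f)ᶜ ∩ {x | f x ≠ 0}) = 0 := by
    by_contra hne
    obtain ⟨K, hKS, hK, hpos⟩ :=
      hS.exists_lt_isCompact_of_ne_top (measure_ne_top μ _) (pos_iff_ne_zero.2 hne)
    refine hpos.ne' (hK.measure_zero_of_nhdsWithin fun a ha => ?_)
    obtain ⟨O, hO, hfO⟩ : ∃ O ∈ 𝓝 a, ∀ᵐ y ∂μ, y ∈ O → f y = 0 := by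
      simpa [essSupport] using (hKS ha).1
    refine ⟨O ∩ K, Filter.inter_mem (mem_nhdsWithin_of_mem_nhds hO) self_mem_nhdsWithin, measure_mono_null (fun y hy => ?_) hfO⟩
    exact fun h => (hKS hy.2).2 (h hy.1)
  refine measure_mono_null (fun x hx => ?_) h0
  have hx' : ¬(x ∉ essSupport μ f → f x = 0) := hx
  push Not at hx'
  exact hx'

theorem essSupport_smul_subset (c : ℝ) (v : Lp ℝ 2 μ) :
    essSupport μ (c • v : Lp ℝ 2 μ) ⊆ essSupport μ v := by
  intro x hx O hO h
  refine hx O hO ?_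
  filter_upwards [h, Lp.coeFn_smul c v] with y hy hcy hyO
  rw [hcy, Pi.smul_apply, hy hyO, smul_zero]

/-- Hölder on O, outside of which v vanishes almost everywhere. -/
theorem eLpNorm_le_of_essSupport_subset [BorelSpace M] [IsFiniteMeasure μ] [μ.Regular]
    (v : Lp ℝ 2 μ) {O : Set M} (hO : IsOpen O) (hv : essSupport μ v ⊆ O) {q : ℝ≥0∞}
    (hq : 2 ≤ q) :
    eLpNorm v 2 μ ≤ eLpNorm v q μ * μ O ^ (1 / (2 : ℝ) - 1 / q.toReal) := by
  have h1 : (v : M → ℝ) =ᵐ[μ] O.indicator v := by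
    filter_upwards [ae_eq_zero_of_notMem_essSupport (Lp.stronglyMeasurable v).measurable]
      with x hx
    by_cases hxO : x ∈ O
    · rw [Set.indicator_of_mem hxO]
    · rw [Set.indicator_of_notMem hxO, hx fun h => hxO (hv h)]
  have h2 := eLpNorm_le_eLpNorm_mul_rpow_measure_univ hq
    ((Lp.stronglyMeasurable v).aestronglyMeasurable (μ := μ.restrict O))
  rw [Measure.restrict_apply_univ, ENNReal.toReal_ofNat] at h2
  rw [eLpNorm_congr_ae h1, eLpNorm_indicator_eq_eLpNorm_restrict hO.measurableSet]
  exact h2.trans (by gcongr; exact Measure.restrict_le_self)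

end EssSupport

section FormBounded

variable {M : Type*} [MeasurableSpace M] {μ : Measure M} [IsFiniteMeasure μ] {E : DirichletForm μ}

/-- Makes the integrability condition in `yamabeInv` automatic. -/
theorem InfFormBounded.integrable {V : M → ℝ} (hVi : AEStronglyMeasurable V μ)
    (hV : E.InfFormBounded fun x => |V x|) (u : E.domain) :
    Integrable (fun x => V x * (u : Lp ℝ 2 μ) x ^ 2) μ := by
  obtain ⟨c, hc⟩ := hV 1 one_pos
  refine (hc u).1.mono' (hVi.mul ((Lp.aestronglyMeasurable (u : Lp ℝ 2 μ)).pow 2))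
    (ae_of_all _ fun x => ?_)
  rw [norm_mul, norm_pow, Real.norm_eq_abs, Real.norm_eq_abs, sq_abs]

end FormBounded

/-! ### Comparison of the local constants at a point -/

section LocalConstants

variable {M : Type*} [TopologicalSpace M] [MeasurableSpace M] {μ : Measure M} [IsFiniteMeasure μ]
  {E : DirichletForm μ}

theorem sobolevInv_le {ν : ℝ} {U : Set M} {u : E.domain}
    (hu : eLpNorm (u : Lp ℝ 2 μ) (sobolevExponent ν) μ = 1)
    (hU : essSupport μ (u : Lp ℝ 2 μ) ⊆ U) :
    E.sobolevInv ν U ≤ ENNReal.ofReal (E.form u u) :=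
  iInf₂_le u ⟨hu, hU⟩

theorem sobolevInv_anti {ν : ℝ} {U U' : Set M} (h : U ⊆ U') :
    E.sobolevInv ν U' ≤ E.sobolevInv ν U :=
  le_iInf₂ fun _ hu => sobolevInv_le hu.1 (hu.2.trans h)

theorem yamabeInv_anti {ν : ℝ} {V : M → ℝ} {U U' : Set M} (h : U ⊆ U') :
    E.yamabeInv ν V U' ≤ E.yamabeInv ν V U :=
  le_iInf₂ fun u hu => iInf₂_le u ⟨hu.1, hu.2.1, hu.2.2.trans h⟩

/-- Scaling to ‖v‖_q = 1 gives the Sobolev inequality for every A > 1/S(U), even without the L²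
term, so B = 1 is an arbitrary choice. -/
theorem optSobolev_le_inv_sobolevInv {ν : ℝ} {U : Set M}
    (hfin : E.optSobolev ν Set.univ ≠ ⊤) : E.optSobolev ν U ≤ (E.sobolevInv ν U)⁻¹ := by
  obtain ⟨A₀, B₀, hS₀⟩ : ∃ A₀ B₀, E.SobolevOn ν Set.univ A₀ B₀ := by
    obtain ⟨A₀, hA₀⟩ := iInf_lt_iff.1 (lt_top_iff_ne_top.2 hfin)
    obtain ⟨⟨-, B₀, -, hS₀⟩, -⟩ := iInf_lt_iff.1 hA₀
    exact ⟨A₀, B₀, hS₀⟩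
  refine le_of_forall_gt fun c hc => ?_
  obtain ⟨c', h1, h2⟩ := exists_between hc
  have hc' : ENNReal.ofReal c'.toReal = c' := ENNReal.ofReal_toReal h2.ne_top
  have hpos : 0 < c'.toReal := ENNReal.toReal_pos (bot_le.trans_lt h1).ne' h2.ne_top
  set A := c'.toReal with hA
  refine (optSobolev_le hpos one_pos fun v hv => ?_).trans_lt (by rwa [hc'])
  -- Functions of infinite L^q norm are invisible to S(U); finiteness of the global constant
  -- excludes them.
  have hNtop : eLpNorm (v : Lp ℝ 2 μ) (sobolevExponent ν) μ ≠ ⊤ := by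
    intro h
    have h3 := hS₀ v (Set.subset_univ _)
    rw [h] at h3
    simp at h3
  obtain ⟨N, hN, hNe⟩ : ∃ N : ℝ, 0 ≤ N ∧
      eLpNorm (v : Lp ℝ 2 μ) (sobolevExponent ν) μ = ENNReal.ofReal N :=
    ⟨_, ENNReal.toReal_nonneg, (ENNReal.ofReal_toReal hNtop).symm⟩
  rw [hNe, ← ENNReal.ofReal_pow hN]
  refine ENNReal.ofReal_le_ofReal ?_
  have hEv := E.nonneg v
  rcases hN.eq_or_lt with h0 | hN0
  · rw [← h0, zero_pow two_ne_zero]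
    positivity
  have hw : eLpNorm ((N⁻¹ • v : E.domain) : Lp ℝ 2 μ) (sobolevExponent ν) μ = 1 := by
    rw [Submodule.coe_smul, eLpNorm_congr_ae (Lp.coeFn_smul N⁻¹ (v : Lp ℝ 2 μ)),
      eLpNorm_const_smul, hNe, Real.enorm_eq_ofReal (by positivity),
      ← ENNReal.ofReal_mul (by positivity), inv_mul_cancel₀ hN0.ne', ENNReal.ofReal_one]
  have h4 := sobolevInv_le (U := U) hw ((essSupport_smul_subset _ _).trans hv)
  have h5 : ENNReal.ofReal A⁻¹ < ENNReal.ofReal (E.form (N⁻¹ • v) (N⁻¹ • v)) := by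
    refine lt_of_lt_of_le ?_ h4
    rw [ENNReal.ofReal_inv_of_pos hpos, hc']
    exact ENNReal.inv_lt_iff_inv_lt.1 h1
  have h6 := (ENNReal.ofReal_lt_ofReal_iff_of_nonneg (by positivity)).1 h5
  rw [map_smul, map_smul, LinearMap.smul_apply, smul_eq_mul, smul_eq_mul] at h6
  have h7 : N ^ 2 ≤ A * E.form v v := by
    have h8 : A⁻¹ * (A * N ^ 2) < N⁻¹ * (N⁻¹ * E.form v v) * (A * N ^ 2) :=
      mul_lt_mul_of_pos_right h6 (by positivity)
    have h9 : A⁻¹ * (A * N ^ 2) = N ^ 2 := by field_simp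
    have h10 : N⁻¹ * (N⁻¹ * E.form v v) * (A * N ^ 2) = A * E.form v v := by field_simp
    rw [h9, h10] at h8
    exact h8.le
  nlinarith [sq_nonneg ‖(v : Lp ℝ 2 μ)‖]

variable [CompactSpace M] [BorelSpace M]

/-- As {x} is null, outer regularity gives neighbourhoods of x of arbitrarily small measure, and
Hölder converts this into smallness in L². -/
theorem exists_ball_norm_sq_le [μ.Regular] (hcomp : E.DistCompatible) {ν : ℝ} (hν : 2 < ν)
    {x : M} (hx : μ {x} = 0) {ε : ℝ} (hε : 0 < ε) :
    ∃ r > 0, ∀ v : Lp ℝ 2 μ, eLpNorm v (sobolevExponent ν) μ = 1 →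
      essSupport μ v ⊆ E.ball x r → ‖v‖ ^ 2 ≤ ε := by
  have hq := two_lt_sobolevExponent hν
  have hqt : 2 < (sobolevExponent ν).toReal := by
    have := (ENNReal.toReal_lt_toReal (by simp) (by simp [sobolevExponent])).2 hq
    simpa using this
  set s : ℝ := 1 / (2 : ℝ) - 1 / (sobolevExponent ν).toReal with hs
  have hs0 : 0 < s := sub_pos.2 (one_div_lt_one_div_of_lt two_pos hqt)
  -- Chosen so that δ ^ s = √ε, where s is the Hölder exponent.
  set δ : ℝ≥0∞ := ENNReal.ofReal (Real.sqrt ε) ^ s⁻¹ with hδ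
  have hδ0 : 0 < δ := ENNReal.rpow_pos (by simpa using hε) (by simp)
  obtain ⟨O, hxO, hO, hOδ⟩ := Set.exists_isOpen_lt_of_lt {x} δ (by rwa [hx])
  obtain ⟨r, hr, hball⟩ := (hcomp x).mem_iff.1 (hO.mem_nhds (hxO rfl))
  refine ⟨r, hr, fun v hv hsupp => ?_⟩
  have h1 := eLpNorm_le_of_essSupport_subset v hO (hsupp.trans hball) hq.le
  rw [hv, one_mul, ← hs] at h1
  have h2 : eLpNorm v 2 μ ≤ ENNReal.ofReal (Real.sqrt ε) := by
    refine h1.trans ((ENNReal.rpow_le_rpow hOδ.le hs0.le).trans (le_of_eq ?_))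
    rw [hδ, ← ENNReal.rpow_mul, inv_mul_cancel₀ hs0.ne', ENNReal.rpow_one]
  have h3 : ‖v‖ ≤ Real.sqrt ε := by
    rw [Lp.norm_def]
    exact ENNReal.toReal_le_of_le_ofReal (Real.sqrt_nonneg _) h2
  calc ‖v‖ ^ 2 ≤ Real.sqrt ε ^ 2 := by gcongr
    _ = ε := Real.sq_sqrt hε.le

/-- For d < 1/A and a small enough ball, the L² term in 1 ≤ A ℰ(u) + B ‖u‖₂² is at most 1 - A d,
which leaves ℰ(u) ≥ d. -/
theorem inv_iSup_sobolevInv_le [μ.Regular] (hcomp : E.DistCompatible) {ν : ℝ} (hν : 2 < ν) {x : M}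
    (hx : μ {x} = 0) :
    (⨆ r ∈ Set.Ioi (0 : ℝ), E.sobolevInv ν (E.ball x r))⁻¹ ≤
      ⨅ r ∈ Set.Ioi (0 : ℝ), E.optSobolev ν (E.ball x r) := by
  refine le_iInf₂ fun r hr => le_of_forall_gt fun c hc => ?_
  obtain ⟨c', h1, h2⟩ := exists_between hc
  have hc' : ENNReal.ofReal c'.toReal = c' := ENNReal.ofReal_toReal h2.ne_top
  rw [← hc'] at h1
  obtain ⟨hA, B, hB, hS⟩ := exists_sobolevOn_of_optSobolev_lt h1
  set A := c'.toReal with hAdef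
  refine lt_of_le_of_lt ?_ h2
  rw [← hc', ENNReal.inv_le_iff_inv_le, ← ENNReal.ofReal_inv_of_pos hA]
  have hlim : Tendsto ENNReal.ofReal (𝓝[<] A⁻¹) (𝓝 (ENNReal.ofReal A⁻¹)) :=
    (ENNReal.continuous_ofReal.tendsto A⁻¹).mono_left nhdsWithin_le_nhds
  refine le_of_tendsto hlim ?_
  filter_upwards [self_mem_nhdsWithin] with d hd
  have hd' : A * d < 1 := by
    have := mul_lt_mul_of_pos_left (Set.mem_Iio.1 hd) hA
    rwa [mul_inv_cancel₀ hA.ne'] at this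
  obtain ⟨r', hr', hsmall⟩ := exists_ball_norm_sq_le hcomp hν hx
    (div_pos (sub_pos.2 hd') hB)
  refine le_trans ?_ (le_iSup₂ (min r r') (Set.mem_Ioi.2 (lt_min hr hr')))
  refine le_iInf₂ fun u hu => ENNReal.ofReal_le_ofReal ?_
  have h3 := hS u (hu.2.trans (ball_mono x (min_le_left _ _)))
  have h4 := hsmall u hu.1 (hu.2.trans (ball_mono x (min_le_right _ _)))
  rw [hu.1, one_pow, ← ENNReal.ofReal_one,
    ENNReal.ofReal_le_ofReal_iff' ] at h3
  have h5 : B * ‖(u : Lp ℝ 2 μ)‖ ^ 2 ≤ 1 - A * d := by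
    rw [le_div_iff₀ hB] at h4
    linarith
  -- The second alternative in `h3` is the absurd 1 ≤ 0 left by the truncation in `ENNReal.ofReal`.
  have h6 : (1 : ℝ) ≤ A * E.form u u + B * ‖(u : Lp ℝ 2 μ)‖ ^ 2 := by
    rcases h3 with h | h
    · exact h
    · linarith
  nlinarith

theorem iInf_optSobolev_eq [μ.Regular] (hcomp : E.DistCompatible) {ν : ℝ} (hν : 2 < ν) {x : M}
    (hx : μ {x} = 0) (hfin : E.optSobolev ν Set.univ ≠ ⊤) :
    ⨅ r ∈ Set.Ioi (0 : ℝ), E.optSobolev ν (E.ball x r) =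
      (⨆ r ∈ Set.Ioi (0 : ℝ), E.sobolevInv ν (E.ball x r))⁻¹ := by
  refine le_antisymm ?_ (inv_iSup_sobolevInv_le hcomp hν hx)
  simp only [ENNReal.inv_iSup]
  exact iInf₂_mono fun r _ => optSobolev_le_inv_sobolevInv hfin

/-- The form bound costs ε ℰ(u) plus c ‖u‖₂², and concentration near x makes the latter at most ε.
-/
theorem exists_ball_schrodinger [μ.Regular] (hcomp : E.DistCompatible) {ν : ℝ} (hν : 2 < ν)
    {x : M} (hx : μ {x} = 0) {V : M → ℝ} (hV : E.InfFormBounded fun x => |V x|) {ε : ℝ}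
    (hε : 0 < ε) :
    ∃ r > 0, ∀ u : E.domain, eLpNorm (u : Lp ℝ 2 μ) (sobolevExponent ν) μ = 1 →
      essSupport μ (u : Lp ℝ 2 μ) ⊆ E.ball x r →
        |E.schrodinger V u - E.form u u| ≤ ε * E.form u u + ε := by
  obtain ⟨c, hc⟩ := hV ε hε
  obtain ⟨r, hr, hsmall⟩ := exists_ball_norm_sq_le hcomp hν hx
    (div_pos hε (by positivity : 0 < |c| + 1))
  refine ⟨r, hr, fun u hu hsupp => ?_⟩
  have h1 := (hc u).2
  have h2 := hsmall u hu hsupp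
  have h3 : ∫ x, (u : Lp ℝ 2 μ) x ^ 2 ∂μ = ‖(u : Lp ℝ 2 μ)‖ ^ 2 := by
    rw [← real_inner_self_eq_norm_sq, L2.inner_def]
    simp [sq]
  have h4 : |∫ x, V x * (u : Lp ℝ 2 μ) x ^ 2 ∂μ| ≤ ∫ x, |V x| * (u : Lp ℝ 2 μ) x ^ 2 ∂μ := by
    refine (abs_integral_le_integral_abs).trans (le_of_eq ?_)
    simp only [abs_mul, abs_pow, sq_abs]
  have h5 : c * ‖(u : Lp ℝ 2 μ)‖ ^ 2 ≤ ε := by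
    rw [le_div_iff₀ (by positivity)] at h2
    nlinarith [le_abs_self c, sq_nonneg ‖(u : Lp ℝ 2 μ)‖]
  rw [h3] at h1
  rw [schrodinger, add_sub_cancel_left]
  linarith

/-- Near x one has (1 - ε) ℰ(u) - ε ≤ ℰ_V(u) ≤ (1 + ε) ℰ(u) + ε for normalised u. Each bound
transfers a near-minimiser of one problem to the other, and then ε → 0. -/
theorem iSup_yamabeInv_eq [μ.Regular] (hcomp : E.DistCompatible) {ν : ℝ} (hν : 2 < ν)
    {x : M} (hx : μ {x} = 0) {V : M → ℝ} (hVi : AEStronglyMeasurable V μ)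
    (hV : E.InfFormBounded fun x => |V x|) :
    ⨆ r ∈ Set.Ioi (0 : ℝ), E.yamabeInv ν V (E.ball x r) =
      ((⨆ r ∈ Set.Ioi (0 : ℝ), E.sobolevInv ν (E.ball x r) : ℝ≥0∞) : EReal) := by
  refine le_antisymm (EReal.le_of_forall_lt_iff_le.1 fun t ht => iSup₂_le fun r hr => ?_)
    (EReal.le_of_forall_lt_iff_le.1 fun t ht => ?_)
  · have hlim : Tendsto (fun ε : ℝ => (((1 + ε) * t + ε : ℝ) : EReal)) (𝓝[>] 0) (𝓝 t) := by
      have h1 : Continuous fun ε : ℝ => (((1 + ε) * t + ε : ℝ) : EReal) :=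
        continuous_coe_real_ereal.comp (by fun_prop)
      have h2 := (h1.tendsto 0).mono_left (nhdsWithin_le_nhds (s := Set.Ioi 0))
      simpa using h2
    refine ge_of_tendsto hlim ?_
    filter_upwards [self_mem_nhdsWithin] with ε hε
    obtain ⟨r', hr', h⟩ := exists_ball_schrodinger hcomp hν hx hV (Set.mem_Ioi.1 hε)
    have h3 : E.sobolevInv ν (E.ball x (min r r')) < ENNReal.ofReal t := by
      refine (le_iSup₂ (f := fun r (_ : r ∈ Set.Ioi (0 : ℝ)) => E.sobolevInv ν (E.ball x r))
        (min r r') (Set.mem_Ioi.2 (lt_min hr hr'))).trans_lt ?_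
      rw [← EReal.coe_ennreal_lt_coe_ennreal_iff, EReal.coe_ennreal_ofReal]
      exact ht.trans_le (by exact_mod_cast le_max_left _ _)
    obtain ⟨u, hu⟩ := iInf_lt_iff.1 h3
    obtain ⟨⟨hu1, hu2⟩, hut⟩ := iInf_lt_iff.1 hu
    have h4 := (ENNReal.ofReal_lt_ofReal_iff_of_nonneg (E.nonneg u)).1 hut
    have h5 := le_of_abs_le (h u hu1 (hu2.trans (ball_mono x (min_le_right _ _))))
    refine (iInf₂_le u ⟨hV.integrable hVi u, hu1, hu2.trans (ball_mono x (min_le_left _ _))⟩).trans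
      (EReal.coe_le_coe_iff.2 ?_)
    have hε' : 0 < ε := hε
    nlinarith
  · have hlim : Tendsto (fun ε : ℝ => (((t + ε) / (1 - ε) : ℝ) : EReal)) (𝓝[>] 0) (𝓝 t) := by
      have h1 : ContinuousAt (fun ε : ℝ => (t + ε) / (1 - ε)) 0 :=
        (by fun_prop : ContinuousAt (fun ε : ℝ => t + ε) 0).div (by fun_prop) (by norm_num)
      have h2 := (continuous_coe_real_ereal.tendsto _).comp
        (h1.tendsto.mono_left (nhdsWithin_le_nhds (s := Set.Ioi 0)))
      simpa [Function.comp_def] using h2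
    refine ge_of_tendsto hlim ?_
    filter_upwards [Ioo_mem_nhdsGT (zero_lt_one' ℝ)] with ε hε
    obtain ⟨r', hr', h⟩ := exists_ball_schrodinger hcomp hν hx hV hε.1
    have key : ∀ r ∈ Set.Ioi (0 : ℝ), 0 ≤ (t + ε) / (1 - ε) ∧
        E.sobolevInv ν (E.ball x r) ≤ ENNReal.ofReal ((t + ε) / (1 - ε)) := by
      intro r hr
      have h3 := (le_iSup₂ (f := fun r (_ : r ∈ Set.Ioi (0 : ℝ)) => E.yamabeInv ν V (E.ball x r))
        (min r r') (Set.mem_Ioi.2 (lt_min hr hr'))).trans_lt ht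
      obtain ⟨u, hu⟩ := iInf_lt_iff.1 h3
      obtain ⟨⟨-, hu1, hu2⟩, hut⟩ := iInf_lt_iff.1 hu
      have h4 := EReal.coe_lt_coe_iff.1 hut
      have h5 := neg_le_of_abs_le (h u hu1 (hu2.trans (ball_mono x (min_le_right _ _))))
      have h6 : E.form u u ≤ (t + ε) / (1 - ε) := by
        rw [le_div_iff₀ (by linarith [hε.2])]
        linarith
      exact ⟨(E.nonneg u).trans h6,
        (sobolevInv_le hu1 (hu2.trans (ball_mono x (min_le_left _ _)))).trans
          (ENNReal.ofReal_le_ofReal h6)⟩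
    have h7 := EReal.coe_ennreal_le_coe_ennreal_iff.2 (iSup₂_le fun r hr => (key r hr).2)
    rwa [EReal.coe_ennreal_ofReal, max_eq_left (key 1 (Set.mem_Ioi.2 one_pos)).1] at h7

end LocalConstants

end DirichletForm

end

theorem mainTheorem8 {M : Type*} [TopologicalSpace M] [CompactSpace M] [T2Space M]
    [MeasurableSpace M] [BorelSpace M] (μ : Measure M) [IsFiniteMeasure μ] [μ.Regular]
    (E : DirichletForm μ) (hreg : E.IsRegular) (hloc : E.IsStronglyLocal)
    (hcomp : E.DistCompatible) (ν : ℝ) (hν : 2 < ν) :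
    ∃ a s : M → ℝ≥0∞,
      (∀ x, Tendsto (fun r : ℝ => E.optSobolev ν (E.ball x r)) (𝓝[>] 0) (𝓝 (a x))) ∧
      (∀ x, Tendsto (fun r : ℝ => E.sobolevInv ν (E.ball x r)) (𝓝[>] 0) (𝓝 (s x))) ∧
      E.optSobolev ν Set.univ = ⨆ x, a x ∧
      ((∀ x, μ {x} = 0) →
        (E.optSobolev ν Set.univ ≠ ⊤ → E.optSobolev ν Set.univ = (⨅ x, s x)⁻¹) ∧
        ∀ V : M → ℝ, Integrable V μ → E.InfFormBounded (fun x => |V x|) →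
          ∃ y : M → EReal,
            (∀ x, Tendsto (fun r : ℝ => E.yamabeInv ν V (E.ball x r)) (𝓝[>] 0) (𝓝 (y x))) ∧
            ((⨅ x, s x : ℝ≥0∞) : EReal) = ⨅ x, y x) := by
  -- All three constants are monotone in the radius, so the limits as r ↘ 0 are an infimum for A_opt
  -- and suprema for S and Y.
  refine ⟨fun x => ⨅ r ∈ Set.Ioi (0 : ℝ), E.optSobolev ν (E.ball x r),
    fun x => ⨆ r ∈ Set.Ioi (0 : ℝ), E.sobolevInv ν (E.ball x r), fun x => ?_, fun x => ?_,
    DirichletForm.optSobolev_univ_eq hreg hloc hcomp hν, fun hx => ⟨fun hfin => ?_,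
      fun V hVi hV => ⟨fun x => ⨆ r ∈ Set.Ioi (0 : ℝ), E.yamabeInv ν V (E.ball x r),
        fun x => ?_, ?_⟩⟩⟩
  · beta_reduce
    rw [← sInf_image]
    exact Monotone.tendsto_nhdsGT
      (fun r r' h => DirichletForm.optSobolev_mono (DirichletForm.ball_mono x h)) 0
  · beta_reduce
    rw [← sSup_image]
    exact Antitone.tendsto_nhdsGT
      (fun r r' h => DirichletForm.sobolevInv_anti (DirichletForm.ball_mono x h)) 0
  · rw [DirichletForm.optSobolev_univ_eq hreg hloc hcomp hν, ENNReal.inv_iInf]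
    exact iSup_congr fun x => DirichletForm.iInf_optSobolev_eq hcomp hν (hx x) hfin
  · beta_reduce
    rw [← sSup_image]
    exact Antitone.tendsto_nhdsGT
      (fun r r' h => DirichletForm.yamabeInv_anti (DirichletForm.ball_mono x h)) 0
  · rw [EReal.coe_ennreal_iInf]
    exact iInf_congr fun x =>
      (DirichletForm.iSup_yamabeInv_eq hcomp hν (hx x) hVi.aestronglyMeasurable hV).symm
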